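/- **Setting.** Let $\mathcal Y$ be a finite set, and let $\{P^q_{Y|X}\}_{q}$ be a family of channels from $\{0,1\}$ to $\mathcal Y$, depending measurably on the state $q$ and continuous in the following sense: for each $q\in[0,1]$ there is a constant $c(q)$ with $\|\log (P^q_{Y|X}/P^{q\pm\xi}_{Y|X})\|_\infty\le c(q)\,\xi$ for all $\xi\in(0,\min(q,1-q))$ (transitions of probability zero in both states are allowed). Let $f:[0,1]\to[0,\infty)$ be Lipschitz continuous. A query is a Lebesgue measurable set $\mathcal A\subseteq[0,1]^d$ of measure $|\mathcal A|$; when the target is $\mathbf s$, the answer $\mathbb 1(\mathbf s\in\mathcal A)$ is sent through the channel $P^{f(|\mathcal A|)}_{Y|X}$, and the player sees the output. Put $\imath_{p,q}(x;y)=\log\frac{P^q_{Y|X}(y|x)}{P_Y^{p,q}(y)}$, where $P_Y^{p,q}$ is the output law of $P^q_{Y|X}$ for a $\mathrm{Bern}(p)$ input, and let $$C_f=\max_{q\in[0,1]}\mathbb E[\imath_{q,f(q)}(X;Y)],\qquad X\sim \mathrm{Bern}(q),\ Y|X\sim P^{f(q)}_{Y|X},$$ this maximum being assumed to exist. An $(l,d,\delta,\varepsilon)$-adaptive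 query procedure consists of queries $\mathcal A_1,\mathcal A_2,\dots$, each depending on the player's private randomness (independent of the target) and on the previous queries and responses; a stopping time $\tau\in\{0,1,2,\dots\}\cup\{\infty\}$ of the responses (possibly randomized); and an estimate $\hat{\mathbf S}\in[0,1]^d$ formed at time $\tau$; such that for every probability density $f_{\mathbf S}$ of the target $\mathbf S$ on $[0,1]^d$ one has $\mathbb E[\tau]\le l$ and $\Pr\{\exists i:\ |\hat S_i-S_i|>\delta\}\le\varepsilon$. Let $\delta^*_{\mathrm a}(l,d,\varepsilon)$ be the infimum of all $\delta>0$ for which such a procedure exists. **Theorem.** Let $d\ge1$. 1. For every $\varepsilon\in(0,1)$ and all $l>0$, $$-\log\delta^*_{\mathrm a}(l,d,\varepsilon)\ \ge\ \frac{l\,C_f}{d(1-\varepsilon)}+O(\log l).$$ 2. (Vanishing excess-resolution probability, the case "$\varepsilon=0$".) For every $k>0$ and all $l>1$, $$-\log\delta^*_{\mathrm a}(l,d,l^{-k})\ \ge\ \frac{l\,C_f}{d}+O(\log l).$$ Here $O(\log l)$ stands for a function $r(l)$ with $r(l)=O(\log l)$ as $l\to\infty$; it may depend on the channel, $f$, $d$,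 and on $\varepsilon$ (respectively $k$). -/

import Mathlib

open MeasureTheory ProbabilityTheory Filter Topology
open scoped NNReal ENNReal

namespace TwentyQuestions

noncomputable section

/-! ### The measurement-dependent channel and its capacity

A measurement-dependent channel is a family `W : ℝ → Bool → PMF 𝒴`: in state `q` the input bit `x`
produces the output `y` with probability `W q x y`. A query of size `a` puts the channel in the
state `f a`. -/

/-- Continuity of the channel in its state: for every `q ∈ [0,1]` there is a constant `c q`,
depending on `q` only, such that for all `ξ ∈ (0, min q (1 - q))` the log-likelihood ratios of the
states `q` and `q ± ξ` are bounded by `c q * ξ` in absolute value, uniformly in input and output.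
The bounds on the logarithms are written multiplicatively; a transition of probability zero in both
states is allowed. -/
def IsContinuousChannel {𝒴 : Type*} (W : ℝ → Bool → PMF 𝒴) : Prop :=
  ∃ c : ℝ → ℝ, ∀ q ∈ Set.Icc (0 : ℝ) 1, ∀ ξ ∈ Set.Ioo 0 (min q (1 - q)),
    ∀ (x : Bool) (y : 𝒴), ∀ q' ∈ ({q + ξ, q - ξ} : Set ℝ),
      (W q x y).toReal ≤ Real.exp (c q * ξ) * (W q' x y).toReal ∧
      (W q' x y).toReal ≤ Real.exp (c q * ξ) * (W q x y).toReal

/-- The Bernoulli probability mass function with parameter `p` (`true` is the bit `1`). -/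
def bern (p : ℝ) (x : Bool) : ℝ := if x then p else 1 - p

/-- The output distribution induced by a `Bern p` input and the channel in state `q`. -/
def outputProb {𝒴 : Type*} (W : ℝ → Bool → PMF 𝒴) (p q : ℝ) (y : 𝒴) : ℝ :=
  ∑ x : Bool, bern p x * (W q x y).toReal

/-- The information density `ı_{p,q}(x;y)`. -/
def infoDensity {𝒴 : Type*} (W : ℝ → Bool → PMF 𝒴) (p q : ℝ) (x : Bool) (y : 𝒴) : ℝ :=
  Real.log ((W q x y).toReal / outputProb W p q y)

/-- `E[ı_{p,q}(X;Y)]` for an input `X ∼ Bern p` and the channel in state `q`. Pairs of probability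
zero contribute zero. -/
def meanInfoDensity {𝒴 : Type*} [Fintype 𝒴] (W : ℝ → Bool → PMF 𝒴) (p q : ℝ) : ℝ :=
  ∑ x : Bool, ∑ y : 𝒴, bern p x * (W q x y).toReal * infoDensity W p q x y

/-- `C` is the capacity `max_{q ∈ [0,1]} E[ı_{q, f q}(X;Y)]`. -/
def IsCapacity {𝒴 : Type*} [Fintype 𝒴] (W : ℝ → Bool → PMF 𝒴) (f : ℝ → ℝ) (C : ℝ) : Prop :=
  IsGreatest ((fun q : ℝ => meanInfoDensity W q (f q)) '' Set.Icc 0 1) C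

/-! ### Adaptive query procedures -/

/-- The unit cube `[0,1]^d`. -/
def cube (d : ℕ) : Set (Fin d → ℝ) := Set.Icc 0 1

/-- `g` is a probability density function on the unit cube. -/
def IsPdfOnCube {d : ℕ} (g : (Fin d → ℝ) → ℝ≥0∞) : Prop :=
  Measurable g ∧ ∫⁻ s in cube d, g s = 1

/-- The law of the target with density `g` on the unit cube. -/
def targetLaw {d : ℕ} (g : (Fin d → ℝ) → ℝ≥0∞) : Measure (Fin d → ℝ) :=
  (volume.restrict (cube d)).withDensity g

/-- An adaptive query procedure for a `d`-dimensional target with responses in `𝒴`. The player may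
randomize: `u : Ω` is the player's private randomness, with law `P`, independent of the target.
Responses are numbered from `0`. The previous queries are functions of `u` and of the previous
responses, so that dependence on them is included. The procedure may stop before any query. -/
structure QueryProcedure (𝒴 : Type*) [MeasurableSpace 𝒴] (d : ℕ) where
  /-- the space of the player's randomness -/
  Ω : Type
  [mΩ : MeasurableSpace Ω]
  /-- the law of the player's randomness -/
  P : Measure Ω
  [isProb : IsProbabilityMeasure P]
  /-- the query posed after the `n` responses `h` -/
  query : Ω → (n : ℕ) → (h : Fin n → 𝒴) → Set (Fin d → ℝ)
  query_subset : ∀ u n h, query u n h ⊆ cube d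
  /-- every query is Lebesgue measurable ... -/
  query_meas : ∀ u n h, NullMeasurableSet (query u n h)
  /-- ... and depends measurably on the player's randomness -/
  query_joint_meas : ∀ n h,
    NullMeasurableSet {p : Ω × (Fin d → ℝ) | p.2 ∈ query p.1 n h} (P.prod volume)
  /-- the estimate formed when stopping after the `n` responses `h` -/
  decode : Ω → (n : ℕ) → (h : Fin n → 𝒴) → Fin d → ℝ
  decode_mem : ∀ u n h, decode u n h ∈ cube d
  decode_meas : ∀ n h, Measurable fun u => decode u n h
  /-- the number of queries made, as a function of the randomness and the response sequence -/
  τ : Ω → (ℕ → 𝒴) → ℕ∞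
  /-- `τ` is a stopping time: whether `τ = n` is determined by the first `n` responses -/
  τ_stopping : ∀ u (n : ℕ) (y y' : ℕ → 𝒴), (∀ i < n, y i = y' i) → τ u y = n → τ u y' = n
  τ_meas : Measurable fun p : Ω × (ℕ → 𝒴) => τ p.1 p.2

attribute [instance] QueryProcedure.mΩ QueryProcedure.isProb

namespace QueryProcedure

variable {𝒴 : Type*} [MeasurableSpace 𝒴] {d : ℕ}

open Classical in
/-- The law of the response to the query posed after the responses `h`, when the target is `s` and
the player's randomness is `u`: the output of the channel in state `f |A|` for the input
`1(s ∈ A)`, where `A` is the query and `|A|` its Lebesgue measure. -/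
def response (W : ℝ → Bool → PMF 𝒴) (f : ℝ → ℝ) (π : QueryProcedure 𝒴 d) (u : π.Ω)
    (s : Fin d → ℝ) (n : ℕ) (h : Fin n → 𝒴) : PMF 𝒴 :=
  W (f (volume (π.query u n h)).toReal) (decide (s ∈ π.query u n h))

variable [Fintype 𝒴] [DiscreteMeasurableSpace 𝒴]

/-- The conditional law of response `n + 1` given the responses `0, …, n`. -/
def responseKernel (W : ℝ → Bool → PMF 𝒴) (f : ℝ → ℝ) (π : QueryProcedure 𝒴 d) (u : π.Ω)
    (s : Fin d → ℝ) (n : ℕ) : Kernel ((i : Finset.Iic n) → 𝒴) 𝒴 :=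
  Kernel.ofFunOfCountable fun h =>
    (π.response W f u s (n + 1)
      fun i => h ⟨i, Finset.mem_Iic.2 (Nat.lt_succ_iff.1 i.2)⟩).toMeasure

instance (W : ℝ → Bool → PMF 𝒴) (f : ℝ → ℝ) (π : QueryProcedure 𝒴 d) (u : π.Ω)
    (s : Fin d → ℝ) (n : ℕ) : IsMarkovKernel (π.responseKernel W f u s n) :=
  ⟨fun _ => PMF.toMeasure.isProbabilityMeasure _⟩

/-- The law of the infinite response sequence `Y₀, Y₁, …` when the target is `s` and the player's
randomness is `u`. -/
def responseLaw (W : ℝ → Bool → PMF 𝒴) (f : ℝ → ℝ) (π : QueryProcedure 𝒴 d) (u : π.Ω)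
    (s : Fin d → ℝ) : Measure (ℕ → 𝒴) :=
  Kernel.trajMeasure (X := fun _ => 𝒴) (π.response W f u s 0 Fin.elim0).toMeasure
    (π.responseKernel W f u s)

/-- The average number of queries `E[τ]` when the target has density `g`. -/
def meanQueries (W : ℝ → Bool → PMF 𝒴) (f : ℝ → ℝ) (π : QueryProcedure 𝒴 d)
    (g : (Fin d → ℝ) → ℝ≥0∞) : ℝ≥0∞ :=
  ∫⁻ s, ∫⁻ u, ∫⁻ y, (π.τ u y : ℝ≥0∞) ∂(π.responseLaw W f u s) ∂π.P ∂(targetLaw g)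

/-- The excess-resolution event for the target `s` and the randomness `u`: the estimate at the
stopping time misses some coordinate of the target by more than `δ`. -/
def excessEvent (π : QueryProcedure 𝒴 d) (δ : ℝ) (u : π.Ω) (s : Fin d → ℝ) : Set (ℕ → 𝒴) :=
  {y | ∃ n : ℕ, π.τ u y = n ∧ ∃ i : Fin d, δ < |π.decode u n (fun j => y j) i - s i|}

/-- The excess-resolution probability when the target has density `g`. -/
def excessProb (W : ℝ → Bool → PMF 𝒴) (f : ℝ → ℝ) (π : QueryProcedure 𝒴 d) (δ : ℝ)
    (g : (Fin d → ℝ) → ℝ≥0∞) : ℝ≥0∞ :=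
  ∫⁻ s, ∫⁻ u, π.responseLaw W f u s (π.excessEvent δ u s) ∂π.P ∂(targetLaw g)

/-- `π` is an `(l, d, δ, ε)`-adaptive query procedure. -/
def IsAdaptive (W : ℝ → Bool → PMF 𝒴) (f : ℝ → ℝ) (π : QueryProcedure 𝒴 d) (l δ ε : ℝ) : Prop :=
  (∀ g, IsPdfOnCube g → π.meanQueries W f g ≤ ENNReal.ofReal l) ∧
  (⨆ (g : (Fin d → ℝ) → ℝ≥0∞) (_ : IsPdfOnCube g), π.excessProb W f δ g) ≤ ENNReal.ofReal ε

end QueryProcedure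

/-- The optimal adaptive resolution `δ*_a(l, d, ε)`: the infimum of all `δ > 0` for which an
`(l, d, δ, ε)`-adaptive query procedure exists. -/
def optResolution {𝒴 : Type*} [MeasurableSpace 𝒴] [Fintype 𝒴] [DiscreteMeasurableSpace 𝒴]
    (W : ℝ → Bool → PMF 𝒴) (f : ℝ → ℝ) (l : ℝ) (d : ℕ) (ε : ℝ) : ℝ≥0∞ :=
  ⨅ (δ : ℝ) (_ : 0 < δ) (_ : ∃ π : QueryProcedure 𝒴 d, π.IsAdaptive W f l δ ε), ENNReal.ofReal δ

end

end TwentyQuestions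

/-!
The procedure is random coding with stop-feedback. If the capacity `C` is zero, no query is
needed. Otherwise it is attained at some `q ∈ (0, 1)`, since a constant input carries no
information. The cube is divided into a grid of `M = m ^ d` cells. For each query, a uniform
random permutation of the cells is drawn, and the cells are filled in that order until the volume
`q` is reached, the last one in part (`gridQuery`). The volume of a query is thus exactly `q`, so
that the channel is always in the state `f q`. A target sends the bit telling whether its cell is
covered; only the partially covered cell leaves its bit undetermined, and the decoder ignores it
(`cellBit`, `metric`).

The queries do not depend on the responses, so that, for a fixed target, queries and responses are
i.i.d. steps (`responseLaw_eq_infinitePi`, `lintegral_gridProcedure`). Every cell has a likelihood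
ratio, a product over the steps, and the player stops when one of them reaches a level `γ`, or at
a horizon `T`. The logarithm for the true cell has drift `C - O(1 / M)` and bounded upward steps,
so by Wald's argument `γ` is reached in mean time `(log γ + O(1)) / (C - O(1 / M))`
(`mean_stepsBelow_le`, `le_sum_stepWeight_mul_log`). The likelihood ratio of a wrong cell grows in
mean by a factor of at most `(M + 1) / (M - 1)` per step, because the positions of two cells under
a random permutation are almost independent (`sum_stepWeight_mul_stepMetric_le`). By Markov's
inequality, the probability of a wrong decision is `O(M T / γ)` plus the probability of reaching
the horizon (`mean_leader_ne_le`).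

With `T` polynomial in `l`, and `γ` equal to `M` times a polynomial in `l`, a grid with `log M = l
C - O(log l)` gives mean time `l` and error probability `l ^ (-k)` (`exists_isAdaptive`). For a
fixed error probability `ε`, the player gives up at once with probability `ε - 1 / l`, which
leaves `l / (1 - ε + 1 / l)` queries on average to the search itself.
-/

namespace TwentyQuestions

noncomputable section

/-! ### Threshold crossing of multiplicative random walks -/

section Walk

variable {A : Type*} {T : ℕ}

/-- The position after `n` steps of the multiplicative walk with step sizes `g (ω 0), g (ω 1), …`
started at `1`; it stays constant after the last letter of `ω`. -/
def walk (g : A → ℝ) (ω : Fin T → A) (n : ℕ) : ℝ :=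
  ∏ t : Fin T, if (t : ℕ) < n then g (ω t) else 1

@[simp] lemma walk_zero (g : A → ℝ) (ω : Fin T → A) : walk g ω 0 = 1 := by simp [walk]

lemma walk_cons (g : A → ℝ) (a : A) (ω : Fin T → A) (n : ℕ) :
    walk g (Fin.cons a ω : Fin (T + 1) → A) (n + 1) = g a * walk g ω n := by
  simp [walk, Fin.prod_univ_succ]

lemma walk_nonneg {g : A → ℝ} (hg : ∀ a, 0 ≤ g a) (ω : Fin T → A) (n : ℕ) : 0 ≤ walk g ω n :=
  Finset.prod_nonneg fun t _ => by split_ifs <;> simp [hg]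

open Classical in
/-- The number of steps, at most `T`, that the walk started at `z` makes strictly below the level
`γ` before it first reaches `γ`. -/
def stepsBelow (g : A → ℝ) (γ z : ℝ) (ω : Fin T → A) : ℕ :=
  ((Finset.range T).filter fun n => ∀ k ≤ n, z * walk g ω k < γ).card

lemma stepsBelow_cons (g : A → ℝ) (γ z : ℝ) (a : A) (ω : Fin T → A) :
    stepsBelow g γ z (Fin.cons a ω : Fin (T + 1) → A) =
      if z < γ then 1 + stepsBelow g γ (z * g a) ω else 0 := by
  classical
  have h (n : ℕ) : (∀ k ≤ n + 1, z * walk g (Fin.cons a ω : Fin (T + 1) → A) k < γ) ↔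
      z < γ ∧ ∀ k ≤ n, z * g a * walk g ω k < γ := by
    constructor
    · intro H
      refine ⟨by simpa using H 0 (Nat.zero_le _), fun k hk => ?_⟩
      have := H (k + 1) (by omega)
      rwa [walk_cons, ← mul_assoc] at this
    · rintro ⟨h0, H⟩ k hk
      cases k with
      | zero => simpa using h0
      | succ k => rw [walk_cons, ← mul_assoc]; exact H k (by omega)
  unfold stepsBelow
  rw [Finset.card_filter, Finset.card_filter, Finset.sum_range_succ']
  simp only [h]
  by_cases hz : z < γ <;> simp [hz, add_comm]

variable [Fintype A]

/-- The total mass of a product weight is the product of the total masses. -/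
lemma sum_prod_weight (w : A → ℝ) (hw : ∑ a, w a = 1) : ∑ ω : Fin T → A, ∏ t, w (ω t) = 1 := by
  rw [← Fintype.prod_sum (fun (_ : Fin T) a => w a)]
  simp [hw]

lemma sum_weight_cons (w : A → ℝ) (F : (Fin (T + 1) → A) → ℝ) :
    ∑ ω : Fin (T + 1) → A, (∏ t, w (ω t)) * F ω =
      ∑ a, w a * ∑ ω : Fin T → A, (∏ t, w (ω t)) * F (Fin.cons a ω) := by
  rw [← (Fin.consEquiv fun _ => A).sum_comp, Fintype.sum_prod_type]
  refine Finset.sum_congr rfl fun a _ => ?_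
  rw [Finset.mul_sum]
  refine Finset.sum_congr rfl fun ω _ => ?_
  simp [Fin.consEquiv, Fin.prod_univ_succ, mul_assoc]

/-- Wald's bound on the mean first passage time: a walk whose logarithm has drift at least `κ` and
whose steps are at most `B` reaches the level `γ` from `z` in mean time at most
`(log (γ B) - log z) / κ`, because it overshoots `γ` by a factor of at most `B`. -/
lemma mean_stepsBelow_le {w g : A → ℝ} {κ B γ : ℝ} (hw : ∀ a, 0 ≤ w a) (hw1 : ∑ a, w a = 1)
    (hg : ∀ a, 0 < w a → 0 < g a) (hgB : ∀ a, g a ≤ B) (hκ : κ ≤ ∑ a, w a * Real.log (g a))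
    (hγ : 0 < γ) (z : ℝ) (hz : 0 < z) (hzB : z ≤ γ * B) :
    κ * ∑ ω : Fin T → A, (∏ t, w (ω t)) * stepsBelow g γ z ω ≤
      Real.log (γ * B) - Real.log z := by
  induction T generalizing z with
  | zero =>
    have := Real.log_le_log hz hzB
    simp [stepsBelow]
    linarith
  | succ T ih =>
    rw [sum_weight_cons]
    simp only [stepsBelow_cons]
    by_cases hzγ : z < γ
    · simp only [hzγ, if_true]
      have key (a : A) : κ * (w a * ∑ ω : Fin T → A, (∏ t, w (ω t)) *
          ((1 + stepsBelow g γ (z * g a) ω : ℕ) : ℝ)) ≤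
          w a * (κ + (Real.log (γ * B) - Real.log z)) - w a * Real.log (g a) := by
        rcases (hw a).eq_or_lt with h0 | h0
        · simp [← h0]
        · have hga := hg a h0
          have h1 := ih (z * g a) (mul_pos hz hga)
            (mul_le_mul hzγ.le (hgB a) hga.le hγ.le)
          rw [Real.log_mul hz.ne' hga.ne'] at h1
          have h2 : ∑ ω : Fin T → A, (∏ t, w (ω t)) *
              ((1 + stepsBelow g γ (z * g a) ω : ℕ) : ℝ) =
              1 + ∑ ω : Fin T → A, (∏ t, w (ω t)) * (stepsBelow g γ (z * g a) ω : ℝ) := by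
            simp only [Nat.cast_add, Nat.cast_one, mul_add, mul_one, Finset.sum_add_distrib,
              sum_prod_weight w hw1]
          rw [h2]
          nlinarith
      rw [Finset.mul_sum]
      refine (Finset.sum_le_sum fun a _ => key a).trans ?_
      rw [Finset.sum_sub_distrib, ← Finset.sum_mul, hw1]
      linarith
    · have := Real.log_le_log hz hzB
      simp only [hzγ, if_false]
      simp
      linarith

/-- The mean of a multiplicative walk whose steps have mean at most `κ`. -/
lemma mean_walk_le {w g : A → ℝ} {κ : ℝ} (hw : ∀ a, 0 ≤ w a) (hw1 : ∑ a, w a = 1)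
    (hg : ∀ a, 0 ≤ g a) (hκ : ∑ a, w a * g a ≤ κ) (hκ1 : 1 ≤ κ) (n : ℕ) :
    ∑ ω : Fin T → A, (∏ t, w (ω t)) * walk g ω n ≤ κ ^ T := by
  have : ∑ ω : Fin T → A, (∏ t, w (ω t)) * walk g ω n =
      ∏ t : Fin T, ∑ a, w a * (if (t : ℕ) < n then g a else 1) := by
    rw [Fintype.prod_sum (fun (t : Fin T) a => w a * (if (t : ℕ) < n then g a else 1))]
    simp only [walk, Finset.prod_mul_distrib]
  rw [this]
  calc _ ≤ ∏ _t : Fin T, κ := by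
        refine Finset.prod_le_prod (fun t _ => Finset.sum_nonneg fun a _ => ?_) fun t _ => ?_
        · exact mul_nonneg (hw a) (by split_ifs <;> simp [hg])
        · split_ifs
          · exact hκ
          · simpa [hw1] using hκ1
    _ = κ ^ T := by simp

end Walk

/-! ### Averages over permutations -/

section Perm

variable {α : Type*} [Fintype α] [DecidableEq α]

/-- A uniform permutation sends a point to a uniform point: composing with a transposition shows
that the sum does not depend on the point. -/
lemma sum_perm_apply (h : α → ℝ) (c : α) :
    (Fintype.card α : ℝ) * ∑ σ : Equiv.Perm α, h (σ c) =
      Fintype.card (Equiv.Perm α) * ∑ a, h a := by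
  have key (c' : α) : ∑ σ : Equiv.Perm α, h (σ c') = ∑ σ : Equiv.Perm α, h (σ c) := by
    rw [← Equiv.sum_comp (Equiv.mulRight (Equiv.swap c c'))]
    simp
  have h1 : ∑ c' : α, ∑ σ : Equiv.Perm α, h (σ c') =
      (Fintype.card α : ℝ) * ∑ σ : Equiv.Perm α, h (σ c) := by
    simp only [key, Finset.sum_const, Finset.card_univ, nsmul_eq_mul]
  rw [← h1, Finset.sum_comm]
  simp only [Equiv.sum_comp, Finset.sum_const, Finset.card_univ, nsmul_eq_mul]

/-- For two distinct points `c ≠ c'`, a uniform permutation sends `c'` to an almost uniform point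
even given the image of `c`: conditional means grow by a factor of at most
`card α / (card α - 1)`. -/
lemma sum_perm_apply_pair_le (g h : α → ℝ) (hg : ∀ a, 0 ≤ g a) (hh : ∀ a, 0 ≤ h a) {c c' : α}
    (hcc : c ≠ c') :
    ((Fintype.card α : ℝ) - 1) * ∑ σ : Equiv.Perm α, g (σ c) * h (σ c') ≤
      (∑ σ : Equiv.Perm α, g (σ c)) * ∑ a, h a := by
  have key (b : α) (hb : b ≠ c) : ∑ σ : Equiv.Perm α, g (σ c) * h (σ b) =
      ∑ σ : Equiv.Perm α, g (σ c) * h (σ c') := by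
    rw [← Equiv.sum_comp (Equiv.mulRight (Equiv.swap c' b))]
    simp [Equiv.swap_apply_of_ne_of_ne hcc hb.symm]
  have h1 : ∑ b ∈ Finset.univ.erase c, ∑ σ : Equiv.Perm α, g (σ c) * h (σ b) =
      ((Fintype.card α : ℝ) - 1) * ∑ σ : Equiv.Perm α, g (σ c) * h (σ c') := by
    rw [Finset.sum_congr rfl fun b hb => key b (Finset.ne_of_mem_erase hb)]
    rw [Finset.sum_const, nsmul_eq_mul, Finset.card_erase_of_mem (Finset.mem_univ c),
      Finset.card_univ, Nat.cast_sub (Fintype.card_pos_iff.2 ⟨c⟩), Nat.cast_one]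
  rw [← h1]
  calc _ ≤ ∑ b, ∑ σ : Equiv.Perm α, g (σ c) * h (σ b) :=
        Finset.sum_le_sum_of_subset_of_nonneg (Finset.subset_univ _) fun b _ _ =>
          Finset.sum_nonneg fun σ _ => mul_nonneg (hg _) (hh _)
    _ = _ := by
        rw [Finset.sum_comm, Finset.sum_mul]
        simp only [← Finset.mul_sum, Equiv.sum_comp]

end Perm

/-! ### Filling a proportion `q` of `M` equal cells -/

/-- The fraction of the cell in position `a` that is covered when the cells of volume `1 / M` are
filled in the order of their positions until the volume `q` is reached. -/
def coverage (q : ℝ) (M a : ℕ) : ℝ := max 0 (min 1 (q * M - a))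

lemma coverage_nonneg (q : ℝ) (M a : ℕ) : 0 ≤ coverage q M a := le_max_left _ _

lemma coverage_le_one (q : ℝ) (M a : ℕ) : coverage q M a ≤ 1 :=
  max_le zero_le_one (min_le_left _ _)

lemma sum_coverage {q : ℝ} (hq0 : 0 ≤ q) (hq1 : q ≤ 1) (M : ℕ) :
    ∑ a : Fin M, coverage q M a = q * M := by
  have key (x : ℝ) (hx : 0 ≤ x) (n : ℕ) :
      ∑ a ∈ Finset.range n, max 0 (min 1 (x - a)) = min x n := by
    induction n with
    | zero => simp [hx]
    | succ n ih =>
      rw [Finset.sum_range_succ, ih]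
      push_cast
      rcases le_total x n with h | h
      · rw [min_eq_left h, min_eq_right (by linarith : x - n ≤ 1), max_eq_left (by linarith),
          min_eq_left (by linarith : x ≤ n + 1), add_zero]
      · rw [min_eq_right h]
        rcases le_total x (n + 1) with h' | h'
        · rw [min_eq_left h', min_eq_right (by linarith), max_eq_right (by linarith)]; ring
        · rw [min_eq_right h', min_eq_left (by linarith), max_eq_right (by linarith)]
  rw [Fin.sum_univ_eq_sum_range (fun a => coverage q M a) M]
  unfold coverage
  rw [key _ (by positivity), min_eq_left]
  nlinarith [(Nat.cast_nonneg M : (0 : ℝ) ≤ M)]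

/-- The channel input produced by a target in the cell in position `a`: the bit `1` if the cell is
covered, `0` if it is disjoint from the query, and undetermined (`none`) for the at most one cell
that is covered in part. -/
def cellBit (q : ℝ) (M a : ℕ) : Option Bool :=
  if coverage q M a = 1 then some true else if coverage q M a = 0 then some false else none

lemma cellBit_eq_true {q : ℝ} {M a : ℕ} : cellBit q M a = some true ↔ coverage q M a = 1 := by
  unfold cellBit; split_ifs <;> simp_all

lemma cellBit_eq_false {q : ℝ} {M a : ℕ} : cellBit q M a = some false ↔ coverage q M a = 0 := by
  unfold cellBit; split_ifs <;> simp_all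

lemma cellBit_eq_none {q : ℝ} {M a : ℕ} (h : cellBit q M a = none) :
    (a : ℝ) < q * M ∧ q * M < a + 1 := by
  unfold cellBit at h
  split_ifs at h with h1 h0
  constructor
  · by_contra hlt
    exact h0 (max_eq_left ((min_le_right _ _).trans (by linarith)))
  · by_contra hlt
    refine h1 ?_
    rw [coverage, min_eq_left (by linarith)]
    simp

/-- Summing a function of the input bits over all cells: `q M` cells carry the bit `1` and
`(1 - q) M` the bit `0`, up to one cell of each kind. -/
lemma exists_sum_cellBit_eq {q : ℝ} (hq0 : 0 ≤ q) (hq1 : q ≤ 1) (M : ℕ) :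
    ∃ n₁ n₀ n : ℝ, n₁ ≤ q * M ∧ n₀ ≤ (1 - q) * M ∧ n ≤ 1 ∧
      n₁ + n₀ + n = M ∧ ∀ F : Option Bool → ℝ,
        ∑ a : Fin M, F (cellBit q M a) = n₁ * F (some true) + n₀ * F (some false) + n * F none := by
  classical
  have hF (F : Option Bool → ℝ) : ∑ a : Fin M, F (cellBit q M a) =
      (∑ a : Fin M, if cellBit q M a = some true then (1 : ℝ) else 0) * F (some true) +
      (∑ a : Fin M, if cellBit q M a = some false then (1 : ℝ) else 0) * F (some false) +
      (∑ a : Fin M, if cellBit q M a = none then (1 : ℝ) else 0) * F none := by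
    simp only [Finset.sum_mul, ← Finset.sum_add_distrib]
    refine Finset.sum_congr rfl fun a _ => ?_
    rcases cellBit q M a with _ | _ | _ <;> simp
  refine ⟨_, _, _, ?_, ?_, ?_, ?_, hF⟩
  · rw [← sum_coverage hq0 hq1 M]
    refine Finset.sum_le_sum fun a _ => ?_
    split_ifs with h
    · exact (cellBit_eq_true.1 h).ge
    · exact coverage_nonneg _ _ _
  · have : (1 - q) * M = ∑ a : Fin M, (1 - coverage q M a) := by
      rw [Finset.sum_sub_distrib, sum_coverage hq0 hq1 M]; simp; ring
    rw [this]
    refine Finset.sum_le_sum fun a _ => ?_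
    split_ifs with h
    · rw [cellBit_eq_false.1 h]; simp
    · linarith [coverage_le_one q M a]
  · rw [Finset.sum_boole]
    norm_cast
    refine Finset.card_le_one.2 fun a ha b hb => ?_
    have h1 := cellBit_eq_none (Finset.mem_filter.1 ha).2
    have h2 := cellBit_eq_none (Finset.mem_filter.1 hb).2
    have h3 : (a : ℝ) < (b : ℕ) + 1 := by linarith
    have h4 : (b : ℝ) < (a : ℕ) + 1 := by linarith
    norm_cast at h3 h4
    exact Fin.ext (by omega)
  · have := hF 1
    simp only [Pi.one_apply, Finset.sum_const, Finset.card_univ, Fintype.card_fin, nsmul_eq_mul,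
      mul_one] at this
    exact this.symm

/-! ### The decoding metric -/

section Metric

variable {𝒴 : Type*} (W : ℝ → Bool → PMF 𝒴) (p q : ℝ)

/-- The factor by which the output `y` multiplies the likelihood ratio of a candidate whose input
bit is `b`, the reference being the output distribution of a `Bern p` input. An undetermined input
bit leaves the likelihood ratio unchanged. -/
def metric (b : Option Bool) (y : 𝒴) : ℝ :=
  b.elim 1 fun x => (W q x y).toReal / outputProb W p q y

variable {W p q}

lemma bern_pos (hp : p ∈ Set.Ioo (0 : ℝ) 1) (x : Bool) : 0 < bern p x := by
  cases x <;> simp [bern, hp.1, hp.2]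

lemma bern_mul_le_outputProb (hp : p ∈ Set.Ioo (0 : ℝ) 1) (x : Bool) (y : 𝒴) :
    bern p x * (W q x y).toReal ≤ outputProb W p q y :=
  Finset.single_le_sum (f := fun x => bern p x * (W q x y).toReal)
    (fun x _ => mul_nonneg (bern_pos hp x).le ENNReal.toReal_nonneg) (Finset.mem_univ x)

lemma outputProb_nonneg (hp : p ∈ Set.Ioo (0 : ℝ) 1) (y : 𝒴) : 0 ≤ outputProb W p q y :=
  Finset.sum_nonneg fun x _ => mul_nonneg (bern_pos hp x).le ENNReal.toReal_nonneg

lemma metric_nonneg (hp : p ∈ Set.Ioo (0 : ℝ) 1) (b : Option Bool) (y : 𝒴) :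
    0 ≤ metric W p q b y := by
  cases b
  · simp [metric]
  · exact div_nonneg ENNReal.toReal_nonneg (outputProb_nonneg hp y)

lemma metric_some_pos (hp : p ∈ Set.Ioo (0 : ℝ) 1) {x : Bool} {y : 𝒴}
    (h : 0 < (W q x y).toReal) : 0 < metric W p q (some x) y :=
  div_pos h ((mul_pos (bern_pos hp x) h).trans_le (bern_mul_le_outputProb hp x y))

lemma metric_le (hp : p ∈ Set.Ioo (0 : ℝ) 1) (b : Option Bool) (y : 𝒴) :
    metric W p q b y ≤ 1 / p + 1 / (1 - p) := by
  have h1 : 1 ≤ 1 / p := by rw [le_div_iff₀ hp.1]; linarith [hp.2]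
  have h2 : 1 ≤ 1 / (1 - p) := by rw [le_div_iff₀ (by linarith [hp.2])]; linarith [hp.1]
  cases b with
  | none => simp only [metric, Option.elim]; linarith
  | some x =>
    have hx : 1 / bern p x ≤ 1 / p + 1 / (1 - p) := by
      cases x <;> simp only [bern, if_true, Bool.false_eq_true, if_false] <;> linarith
    refine le_trans (div_le_of_le_mul₀ (outputProb_nonneg hp y) (one_div_pos.2 (bern_pos hp x)).le
      ?_) hx
    rw [one_div, inv_mul_eq_div, le_div_iff₀ (bern_pos hp x), mul_comm]
    exact bern_mul_le_outputProb hp x y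

lemma sum_bern_mul_metric_le (y : 𝒴) :
    p * metric W p q (some true) y + (1 - p) * metric W p q (some false) y ≤ 1 := by
  have : p * metric W p q (some true) y + (1 - p) * metric W p q (some false) y =
      outputProb W p q y / outputProb W p q y := by
    simp only [metric, Option.elim, outputProb, bern, Fintype.sum_bool]
    simp
    ring
  rw [this]
  exact div_self_le_one _

/-- Over all cells, the metric of a fixed output averages to at most `1 + 1 / M`. -/
lemma sum_metric_cellBit_le (hp : p ∈ Set.Ioo (0 : ℝ) 1) (M : ℕ) (y : 𝒴) :
    ∑ a : Fin M, metric W p q (cellBit p M a) y ≤ M + 1 := by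
  obtain ⟨n₁, n₀, n, h₁, h₀, h, -, hF⟩ := exists_sum_cellBit_eq hp.1.le hp.2.le M
  rw [hF fun b => metric W p q b y]
  have e1 := mul_le_mul_of_nonneg_right h₁ (metric_nonneg (W := W) (q := q) hp (some true) y)
  have e0 := mul_le_mul_of_nonneg_right h₀ (metric_nonneg (W := W) (q := q) hp (some false) y)
  have e2 := mul_le_mul_of_nonneg_left (sum_bern_mul_metric_le (W := W) (p := p) (q := q) y)
    (Nat.cast_nonneg M)
  have e3 : metric W p q none y = 1 := rfl
  rw [e3]
  linarith

/-! ### One query: a uniform permutation of the cells and the response to it -/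

variable (W q) in
/-- The joint probability of a permutation `σ` of the `M` cells, drawn uniformly, and of the
response `y`, when the target is in cell `c` and sends the bit `bit a` if its cell is in
position `a`. -/
def stepWeight {M : ℕ} (bit : Fin M → Bool) (c : Fin M) (a : Equiv.Perm (Fin M) × 𝒴) : ℝ :=
  (Fintype.card (Equiv.Perm (Fin M)) : ℝ)⁻¹ * (W q (bit (a.1 c)) a.2).toReal

variable (W p q) in
/-- The factor by which one query and its response multiply the likelihood ratio of cell `c`. -/
def stepMetric {M : ℕ} (c : Fin M) (a : Equiv.Perm (Fin M) × 𝒴) : ℝ :=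
  metric W p q (cellBit p M (a.1 c)) a.2

variable {M : ℕ} {bit : Fin M → Bool} {c c' : Fin M}

lemma stepWeight_nonneg (a : Equiv.Perm (Fin M) × 𝒴) : 0 ≤ stepWeight W q bit c a :=
  mul_nonneg (by positivity) ENNReal.toReal_nonneg

lemma stepMetric_pos (hp : p ∈ Set.Ioo (0 : ℝ) 1)
    (hbit : ∀ a b, cellBit p M (a : Fin M) = some b → bit a = b)
    (a : Equiv.Perm (Fin M) × 𝒴) (ha : 0 < stepWeight W q bit c a) :
    0 < stepMetric W p q c a := by
  unfold stepMetric
  rcases h : cellBit p M (a.1 c) with _ | b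
  · simp [metric]
  · refine metric_some_pos hp ?_
    rw [← hbit _ _ h]
    exact pos_of_mul_pos_right ha (by positivity)

/-! ### Drift of the true cell and growth of the wrong ones -/

variable [Fintype 𝒴]

variable (W p q) in
/-- The mean of the logarithmic metric of a candidate with input bit `b` when that bit is sent; it
is zero for an undetermined bit, whose metric is `1`. -/
def drift (b : Option Bool) : ℝ :=
  b.elim 0 fun x => ∑ y, (W q x y).toReal * infoDensity W p q x y

lemma meanInfoDensity_eq : meanInfoDensity W p q =
    p * drift W p q (some true) + (1 - p) * drift W p q (some false) := by
  simp [meanInfoDensity, drift, bern, Finset.mul_sum, mul_assoc]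

/-- A constant input carries no information, so a positive capacity is attained inside `(0, 1)`. -/
lemma meanInfoDensity_of_deterministic {p : ℝ} (hp : p = 0 ∨ p = 1) (v : ℝ) :
    meanInfoDensity W p v = 0 := by
  refine Finset.sum_eq_zero fun x _ => Finset.sum_eq_zero fun y _ => ?_
  by_cases h : (W v x y).toReal = 0
  · simp [h]
  · rcases hp with rfl | rfl <;> cases x <;> simp [bern, infoDensity, outputProb, h]

lemma le_sum_drift_cellBit (hp : p ∈ Set.Icc (0 : ℝ) 1) (M : ℕ) :
    M * meanInfoDensity W p q - (|drift W p q (some true)| + |drift W p q (some false)|) ≤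
      ∑ a : Fin M, drift W p q (cellBit p M a) := by
  obtain ⟨n₁, n₀, n, h₁, h₀, h, hs, hF⟩ := exists_sum_cellBit_eq hp.1 hp.2 M
  rw [hF, meanInfoDensity_eq]
  have e3 : drift W p q none = 0 := rfl
  have e1 : (p * M - n₁) * drift W p q (some true) ≤ 1 * |drift W p q (some true)| :=
    (mul_le_mul_of_nonneg_left (le_abs_self _) (by linarith)).trans
      (mul_le_mul_of_nonneg_right (by linarith) (abs_nonneg _))
  have e0 : ((1 - p) * M - n₀) * drift W p q (some false) ≤ 1 * |drift W p q (some false)| :=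
    (mul_le_mul_of_nonneg_left (le_abs_self _) (by linarith)).trans
      (mul_le_mul_of_nonneg_right (by linarith) (abs_nonneg _))
  rw [e3]
  linarith

lemma sum_toReal_pmf (P : PMF 𝒴) : ∑ y, (P y).toReal = 1 := by
  rw [← ENNReal.toReal_sum fun y _ => P.apply_ne_top y, ← tsum_fintype (L := .unconditional 𝒴),
    P.tsum_coe]
  simp

lemma sum_stepWeight : ∑ a, stepWeight W q bit c a = 1 := by
  simp only [stepWeight, Fintype.sum_prod_type, ← Finset.mul_sum, sum_toReal_pmf]
  simp

/-- The drift of the logarithmic likelihood ratio of the true cell is the mean information density,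
up to the contribution of a single cell. -/
lemma le_sum_stepWeight_mul_log (hp : p ∈ Set.Icc (0 : ℝ) 1)
    (hbit : ∀ a b, cellBit p M (a : Fin M) = some b → bit a = b) :
    meanInfoDensity W p q - (|drift W p q (some true)| + |drift W p q (some false)|) / M ≤
      ∑ a, stepWeight W q bit c a * Real.log (stepMetric W p q c a) := by
  have hM : (0 : ℝ) < M := by exact_mod_cast c.pos
  have h1 (σ : Equiv.Perm (Fin M)) : ∑ y, (W q (bit (σ c)) y).toReal *
      Real.log (metric W p q (cellBit p M (σ c)) y) = drift W p q (cellBit p M (σ c)) := by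
    rcases h : cellBit p M (σ c) with _ | b
    · simp [metric, drift]
    · simp [metric, drift, infoDensity, hbit _ _ h]
  have h2 : ∑ a, stepWeight W q bit c a * Real.log (stepMetric W p q c a) =
      (Fintype.card (Equiv.Perm (Fin M)) : ℝ)⁻¹ *
        ∑ σ : Equiv.Perm (Fin M), drift W p q (cellBit p M (σ c)) := by
    simp only [stepWeight, stepMetric, Fintype.sum_prod_type, mul_assoc, ← Finset.mul_sum, h1]
  have h3 := sum_perm_apply (fun a : Fin M => drift W p q (cellBit p M a)) c
  have hc : (0 : ℝ) < Fintype.card (Equiv.Perm (Fin M)) := by positivity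
  have h4 : (Fintype.card (Equiv.Perm (Fin M)) : ℝ)⁻¹ *
        ∑ σ : Equiv.Perm (Fin M), drift W p q (cellBit p M (σ c)) =
      (∑ a : Fin M, drift W p q (cellBit p M a)) / M := by
    rw [eq_div_iff hM.ne', inv_mul_eq_div, div_mul_eq_mul_div, div_eq_iff hc.ne',
      mul_comm _ (M : ℝ), mul_comm _ (Fintype.card _ : ℝ), ← h3, Fintype.card_fin]
  rw [h2, h4, le_div_iff₀ hM, sub_mul, div_mul_cancel₀ _ hM.ne']
  have := le_sum_drift_cellBit (W := W) (q := q) hp M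
  linarith

/-- The likelihood ratio of a wrong cell grows in mean by a factor of at most
`(M + 1) / (M - 1)` per query. -/
lemma sum_stepWeight_mul_stepMetric_le (hp : p ∈ Set.Ioo (0 : ℝ) 1) (hcc : c ≠ c') :
    ∑ a, stepWeight W q bit c a * stepMetric W p q c' a ≤ ((M : ℝ) + 1) / (M - 1) := by
  have hM : (0 : ℝ) < M - 1 := by
    have h1 : 1 < M := by
      have := Fin.val_ne_of_ne hcc
      omega
    have : (1 : ℝ) < M := by exact_mod_cast h1
    linarith
  rw [le_div_iff₀ hM, mul_comm, Finset.mul_sum, Fintype.sum_prod_type_right]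
  have hy (y : 𝒴) : ∑ σ : Equiv.Perm (Fin M), ((M : ℝ) - 1) *
      (stepWeight W q bit c (σ, y) * stepMetric W p q c' (σ, y)) ≤
      ∑ σ, stepWeight W q bit c (σ, y) * (M + 1) := by
    have h := sum_perm_apply_pair_le
      (fun a : Fin M => (Fintype.card (Equiv.Perm (Fin M)) : ℝ)⁻¹ * (W q (bit a) y).toReal)
      (fun a : Fin M => metric W p q (cellBit p M a) y)
      (fun a => mul_nonneg (by positivity) ENNReal.toReal_nonneg)
      (fun a => metric_nonneg hp _ _) hcc
    rw [Fintype.card_fin] at h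
    rw [← Finset.mul_sum, ← Finset.sum_mul]
    exact h.trans (mul_le_mul_of_nonneg_left (sum_metric_cellBit_le hp M y)
      (Finset.sum_nonneg fun σ _ => stepWeight_nonneg (σ, y)))
  refine (Finset.sum_le_sum fun y _ => hy y).trans ?_
  rw [← Fintype.sum_prod_type_right (fun a => stepWeight W q bit c a * ((M : ℝ) + 1)),
    ← Finset.sum_mul, sum_stepWeight, one_mul]

end Metric

/-! ### Queries on a grid of the cube -/

section Grid

variable {d m : ℕ}

/-- The lowest corner of cell `c` of the grid that divides every side of the cube into `m` equal
parts. -/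
def corner (c : Fin (m ^ d)) (i : Fin d) : ℝ := (finFunctionFinEquiv.symm c i : ℝ) / m

/-- The part of the half-open grid cell `c` in which the coordinate `i₀` belongs to the lowest
fraction `w` of its range. -/
def slab (i₀ : Fin d) (c : Fin (m ^ d)) (w : ℝ) : Set (Fin d → ℝ) :=
  Set.univ.pi fun i => Set.Ico (corner c i) (corner c i + (if i = i₀ then w else 1) / m)

variable {i₀ : Fin d} {c c' : Fin (m ^ d)} {w : ℝ} {s : Fin d → ℝ}

lemma mem_slab : s ∈ slab i₀ c w ↔
    ∀ i, corner c i ≤ s i ∧ s i < corner c i + (if i = i₀ then w else 1) / m := by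
  simp [slab]

lemma measurableSet_slab : MeasurableSet (slab i₀ c w) :=
  MeasurableSet.univ_pi fun _ => measurableSet_Ico

lemma slab_mono {w' : ℝ} (h : w ≤ w') : slab i₀ c w ⊆ slab i₀ c w' := by
  intro s hs
  rw [mem_slab] at hs ⊢
  refine fun i => ⟨(hs i).1, (hs i).2.trans_le ?_⟩
  split_ifs <;> gcongr

lemma slab_zero : slab i₀ c 0 = ∅ := by
  refine Set.eq_empty_of_forall_notMem fun s hs => ?_
  have := mem_slab.1 hs i₀
  simp at this
  linarith

lemma corner_nonneg (i : Fin d) : 0 ≤ corner c i := by unfold corner; positivity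

lemma side_pos (c : Fin (m ^ d)) (i : Fin d) : (0 : ℝ) < m := by
  exact_mod_cast (finFunctionFinEquiv.symm c i).pos

lemma corner_add_le_one (i : Fin d) : corner c i + 1 / m ≤ 1 := by
  have hm := side_pos c i
  rw [corner, ← add_div, div_le_one hm]
  exact_mod_cast (finFunctionFinEquiv.symm c i).isLt

lemma corner_mem_cube : corner c ∈ cube d := by
  refine ⟨fun i => corner_nonneg i, fun i => ?_⟩
  have : (0 : ℝ) ≤ 1 / m := by positivity
  exact (le_add_of_nonneg_right this).trans (corner_add_le_one i)

lemma slab_subset_cube (hw : w ≤ 1) : slab i₀ c w ⊆ cube d := by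
  intro s hs
  have hs := mem_slab.1 (slab_mono hw hs)
  simp only [ite_self] at hs
  exact ⟨fun i => (corner_nonneg i).trans (hs i).1,
    fun i => (hs i).2.le.trans (corner_add_le_one i)⟩

lemma abs_corner_sub_le (hs : s ∈ slab i₀ c 1) (i : Fin d) : |corner c i - s i| ≤ 1 / m := by
  have h := mem_slab.1 hs i
  simp only [ite_self] at h
  rw [abs_le]
  constructor <;> linarith [h.1, h.2]

lemma eq_of_mem_slab (hs : s ∈ slab i₀ c 1) (hs' : s ∈ slab i₀ c' 1) : c = c' := by
  rw [mem_slab] at hs hs'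
  simp only [ite_self, corner, ← add_div] at hs hs'
  refine finFunctionFinEquiv.symm.injective (funext fun i => Fin.ext ?_)
  have hm := side_pos c i
  have h1 := (hs i).1.trans_lt (hs' i).2
  have h2 := (hs' i).1.trans_lt (hs i).2
  rw [div_lt_div_iff_of_pos_right hm] at h1 h2
  norm_cast at h1 h2
  omega

lemma exists_mem_slab (hm : 0 < m) (i₀ : Fin d) (h0 : ∀ i, 0 ≤ s i) (h1 : ∀ i, s i < 1) :
    ∃ c : Fin (m ^ d), s ∈ slab i₀ c 1 := by
  have hm' : (0 : ℝ) < m := by exact_mod_cast hm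
  have hlt (i : Fin d) : ⌊m * s i⌋₊ < m := by
    rw [Nat.floor_lt (mul_nonneg hm'.le (h0 i))]
    nlinarith [h1 i]
  refine ⟨finFunctionFinEquiv fun i => ⟨⌊m * s i⌋₊, hlt i⟩, mem_slab.2 fun i => ?_⟩
  simp only [corner, Equiv.symm_apply_apply, ite_self, ← add_div]
  rw [div_le_iff₀ hm', lt_div_iff₀ hm', mul_comm (s i)]
  exact ⟨Nat.floor_le (mul_nonneg hm'.le (h0 i)), Nat.lt_floor_add_one _⟩

lemma volume_slab (hw : 0 ≤ w) :
    volume (slab i₀ c w) = ENNReal.ofReal (w / (m : ℝ) ^ d) := by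
  have hm := side_pos c i₀
  rw [slab, Real.volume_pi_Ico, ← ENNReal.ofReal_prod_of_nonneg]
  · congr 1
    simp only [add_sub_cancel_left, Finset.prod_div_distrib, Finset.prod_ite_eq',
      Finset.mem_univ, if_true, Finset.prod_const, Finset.card_univ, Fintype.card_fin]
  · intro i _
    rw [add_sub_cancel_left]
    split_ifs <;> positivity

/-- The query that fills the cells of the grid in the order given by their positions under `σ`,
until the volume `q` is reached. -/
def gridQuery (i₀ : Fin d) (q : ℝ) (σ : Equiv.Perm (Fin (m ^ d))) : Set (Fin d → ℝ) :=
  ⋃ c, slab i₀ c (coverage q (m ^ d) (σ c))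

variable {q : ℝ} {σ : Equiv.Perm (Fin (m ^ d))}

lemma gridQuery_subset_cube : gridQuery i₀ q σ ⊆ cube d :=
  Set.iUnion_subset fun _ => slab_subset_cube (coverage_le_one _ _ _)

lemma measurableSet_gridQuery : MeasurableSet (gridQuery i₀ q σ) :=
  MeasurableSet.iUnion fun _ => measurableSet_slab

/-- Every query has volume exactly `q`, so that the channel is always in the same state. -/
lemma volume_gridQuery (hm : 0 < m) (hq0 : 0 ≤ q) (hq1 : q ≤ 1) :
    volume (gridQuery i₀ q σ) = ENNReal.ofReal q := by
  have hm' : (0 : ℝ) < (m : ℝ) ^ d := by positivity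
  rw [gridQuery, measure_iUnion ?_ fun _ => measurableSet_slab, tsum_fintype]
  · simp only [volume_slab (coverage_nonneg _ _ _)]
    rw [← ENNReal.ofReal_sum_of_nonneg fun c _ =>
      div_nonneg (coverage_nonneg _ _ _) hm'.le, ← Finset.sum_div,
      Equiv.sum_comp σ fun a : Fin (m ^ d) => coverage q (m ^ d) a, sum_coverage hq0 hq1]
    congr 1
    push_cast
    exact mul_div_cancel_right₀ _ hm'.ne'
  · intro c c' hcc
    refine Set.disjoint_left.2 fun s hs hs' => hcc ?_
    exact eq_of_mem_slab (slab_mono (coverage_le_one _ _ _) hs)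
      (slab_mono (coverage_le_one _ _ _) hs')

lemma mem_gridQuery (hs : s ∈ slab i₀ c 1) :
    s ∈ gridQuery i₀ q σ ↔ s ∈ slab i₀ c (coverage q (m ^ d) (σ c)) := by
  refine ⟨fun h => ?_, fun h => Set.mem_iUnion.2 ⟨c, h⟩⟩
  obtain ⟨c', hc'⟩ := Set.mem_iUnion.1 h
  rwa [eq_of_mem_slab hs (slab_mono (coverage_le_one _ _ _) hc')]

open Classical in
/-- The bit sent by the target `s` when its cell `c` is in position `a`. -/
def targetBit (i₀ : Fin d) (q : ℝ) (c : Fin (m ^ d)) (s : Fin d → ℝ) (a : Fin (m ^ d)) : Bool :=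
  decide (s ∈ slab i₀ c (coverage q (m ^ d) a))

lemma targetBit_eq (hs : s ∈ slab i₀ c 1) (a : Fin (m ^ d)) (b : Bool)
    (h : cellBit q (m ^ d) a = some b) : targetBit i₀ q c s a = b := by
  cases b
  · simp [targetBit, cellBit_eq_false.1 h, slab_zero]
  · simp [targetBit, cellBit_eq_true.1 h, hs]

/-- Almost every target has no coordinate equal to `1`, and so lies in a half-open grid cell. -/
lemma ae_targetLaw_mem (g : (Fin d → ℝ) → ℝ≥0∞) :
    ∀ᵐ s ∂targetLaw g, (∀ i, 0 ≤ s i) ∧ ∀ i, s i < 1 := by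
  suffices h : ∀ᵐ s ∂volume.restrict (cube d), (∀ i, 0 ≤ s i) ∧ ∀ i, s i < 1 from
    (withDensity_absolutelyContinuous _ _).ae_le h
  have hc : MeasurableSet (cube d) := measurableSet_Icc
  rw [ae_restrict_iff' hc]
  have h : ∀ i : Fin d, ∀ᵐ s : Fin d → ℝ, s i ≠ 1 := fun i => by
    rw [ae_iff]
    simpa [volume_pi] using Measure.pi_hyperplane (fun _ : Fin d => (volume : Measure ℝ)) i 1
  filter_upwards [ae_all_iff.2 h] with s hs hsc
  exact ⟨hsc.1, fun i => lt_of_le_of_ne (hsc.2 i) (hs i)⟩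

lemma targetLaw_univ {g : (Fin d → ℝ) → ℝ≥0∞} (hg : IsPdfOnCube g) :
    targetLaw g Set.univ = 1 := by
  rw [targetLaw, withDensity_apply _ MeasurableSet.univ, setLIntegral_univ, hg.2]

lemma lintegral_targetLaw_le {g : (Fin d → ℝ) → ℝ≥0∞} (hg : IsPdfOnCube g)
    {F : (Fin d → ℝ) → ℝ≥0∞} {L : ℝ≥0∞} (hF : ∀ s, (∀ i, 0 ≤ s i) → (∀ i, s i < 1) → F s ≤ L) :
    ∫⁻ s, F s ∂targetLaw g ≤ L := by
  calc _ ≤ ∫⁻ _, L ∂targetLaw g :=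
        lintegral_mono_ae ((ae_targetLaw_mem g).mono fun s hs => hF s hs.1 hs.2)
    _ = L := by rw [lintegral_const, targetLaw_univ hg, mul_one]

end Grid

/-! ### Non-adaptive queries: the responses are independent -/

section Responses

variable {𝒴 : Type*} [MeasurableSpace 𝒴] {d : ℕ} [Fintype 𝒴] [DiscreteMeasurableSpace 𝒴]
  {W : ℝ → Bool → PMF 𝒴} {f : ℝ → ℝ} {π : QueryProcedure 𝒴 d} {u : π.Ω} {s : Fin d → ℝ}

lemma isProbabilityMeasure_responseLaw : IsProbabilityMeasure (π.responseLaw W f u s) := by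
  have := PMF.toMeasure.isProbabilityMeasure (π.response W f u s 0 Fin.elim0)
  unfold QueryProcedure.responseLaw
  infer_instance

/-- If the queries do not depend on the responses, then the responses are independent. -/
lemma responseLaw_eq_infinitePi (P : ℕ → PMF 𝒴) (h : ∀ n h, π.response W f u s n h = P n) :
    π.responseLaw W f u s = Measure.infinitePi fun n => (P n).toMeasure := by
  have hp (n : ℕ) : IsProbabilityMeasure ((P n).toMeasure) :=
    PMF.toMeasure.isProbabilityMeasure _
  have h1 : π.responseLaw W f u s = Measure.infinitePiNat fun n => (P n).toMeasure := by
    have hk : π.responseKernel W f u s = fun n => Kernel.const _ (P (n + 1)).toMeasure := by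
      funext n
      ext1 x
      simp only [QueryProcedure.responseKernel, h]
      rfl
    unfold QueryProcedure.responseLaw Kernel.trajMeasure Measure.infinitePiNat
    simp only [hk, h]
    congr 1
    refine (Measure.pi_eq fun t ht => ?_).symm
    rw [Measure.map_apply (by fun_prop) (MeasurableSet.univ_pi ht)]
    have hpre : (MeasurableEquiv.piUnique fun _ : Finset.Iic 0 => 𝒴).symm ⁻¹' Set.univ.pi t =
        t default := by
      ext y
      exact ⟨fun H => H default trivial, fun H i _ => by rwa [Subsingleton.elim i default]⟩
    rw [hpre, Fintype.prod_subsingleton _ (default : Finset.Iic 0)]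
    rfl
  rw [h1]
  exact (Measure.isProjectiveLimit_infinitePiNat _).unique (Measure.isProjectiveLimit_infinitePi _)

/-- The mean of a function of the first `T` responses to non-adaptive queries. -/
lemma lintegral_responseLaw (P : ℕ → PMF 𝒴) (h : ∀ n h, π.response W f u s n h = P n) {T : ℕ}
    (G : (Fin T → 𝒴) → ℝ≥0∞) :
    ∫⁻ y, G (fun t => y t) ∂π.responseLaw W f u s = ∑ y, (∏ t : Fin T, P t (y t)) * G y := by
  have hp (n : ℕ) : IsProbabilityMeasure ((P n).toMeasure) :=
    PMF.toMeasure.isProbabilityMeasure _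
  have hmeas : Measurable fun (y : ℕ → 𝒴) (t : Fin T) => y t := by fun_prop
  rw [← lintegral_map (μ := π.responseLaw W f u s) (f := G) (measurable_of_finite G) hmeas,
    lintegral_fintype]
  refine Finset.sum_congr rfl fun y _ => ?_
  rw [mul_comm, Measure.map_apply hmeas (measurableSet_singleton y),
    responseLaw_eq_infinitePi P h]
  congr 1
  have h1 : (fun (x : ℕ → 𝒴) (t : Fin T) => x t) ⁻¹' {y} =
      Set.pi (Finset.range T) fun n => if hn : n < T then {y ⟨n, hn⟩} else Set.univ := by
    ext x
    simp only [Set.mem_preimage, Set.mem_singleton_iff, Set.mem_pi, Finset.coe_range, Set.mem_Iio,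
      funext_iff]
    constructor
    · intro hx n hn
      simpa [hn] using hx ⟨n, hn⟩
    · intro hx t
      simpa using hx t t.isLt
  rw [h1, Measure.infinitePi_pi]
  · rw [Finset.prod_range]
    refine Finset.prod_congr rfl fun t _ => ?_
    rw [dif_pos t.isLt, PMF.toMeasure_apply_singleton _ _ (measurableSet_singleton _)]
  · intro n hn
    exact MeasurableSet.of_discrete

end Responses

/-! ### Sequential decoding -/

section Decoder

variable {A ι : Type*} {T : ℕ}

lemma walk_congr (g : A → ℝ) {ω ω' : Fin T → A} {n : ℕ}
    (h : ∀ t : Fin T, (t : ℕ) < n → ω t = ω' t) : walk g ω n = walk g ω' n :=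
  Finset.prod_congr rfl fun t _ => by
    split_ifs with ht
    · rw [h t ht]
    · rfl

open Classical in
/-- The first time at which one of the walks with steps `g c`, started at `1`, reaches the level
`γ`, or the horizon `T` if this does not happen before. -/
def stopTime (g : ι → A → ℝ) (γ : ℝ) (ω : Fin T → A) : ℕ :=
  Nat.find (p := fun n => n = T ∨ ∃ c, γ ≤ walk (g c) ω n) ⟨T, Or.inl rfl⟩

open Classical in
/-- Some candidate whose likelihood ratio `z c` reaches the level `γ`, if there is one. -/
def leader [Inhabited ι] (γ : ℝ) (z : ι → ℝ) : ι :=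
  if h : ∃ c, γ ≤ z c then h.choose else default

variable {g : ι → A → ℝ} {γ : ℝ}

lemma stopTime_eq_iff {ω : Fin T → A} {n : ℕ} : stopTime g γ ω = n ↔
    (n = T ∨ ∃ c, γ ≤ walk (g c) ω n) ∧ ∀ k < n, ¬(k = T ∨ ∃ c, γ ≤ walk (g c) ω k) := by
  classical
  exact Nat.find_eq_iff _

lemma stopTime_le (ω : Fin T → A) : stopTime g γ ω ≤ T := by
  classical
  exact Nat.find_le (Or.inl rfl)

lemma stopTime_congr {ω ω' : Fin T → A} {n : ℕ} (h : ∀ t : Fin T, (t : ℕ) < n → ω t = ω' t)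
    (hn : stopTime g γ ω = n) : stopTime g γ ω' = n := by
  rw [stopTime_eq_iff] at hn ⊢
  have hw (k : ℕ) (hk : k ≤ n) (c : ι) : walk (g c) ω' k = walk (g c) ω k :=
    walk_congr _ fun t ht => (h t (ht.trans_le hk)).symm
  refine ⟨by simpa only [hw n le_rfl] using hn.1, fun k hk => ?_⟩
  simpa only [hw k hk.le] using hn.2 k hk

lemma stopTime_le_stepsBelow (c : ι) (ω : Fin T → A) :
    stopTime g γ ω ≤ stepsBelow (g c) γ 1 ω := by
  classical
  have hsub : Finset.range (stopTime g γ ω) ⊆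
      (Finset.range T).filter fun n => ∀ k ≤ n, 1 * walk (g c) ω k < γ := by
    intro n hn
    rw [Finset.mem_range] at hn
    refine Finset.mem_filter.2 ⟨Finset.mem_range.2 (hn.trans_le (stopTime_le ω)), fun k hk => ?_⟩
    have := (stopTime_eq_iff (g := g) (γ := γ) (ω := ω)).1 rfl |>.2 k (hk.trans_lt hn)
    push Not at this
    rw [one_mul]
    exact this.2 c
  have := Finset.card_le_card hsub
  rwa [Finset.card_range] at this

variable [Fintype ι] [DecidableEq ι] [Inhabited ι]

/-- If the decoder misses `c`, then either another candidate has reached the threshold or the true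
one has not reached it before the horizon. -/
lemma one_le_of_leader_ne (hg : ∀ c a, 0 ≤ g c a) (hγ : 0 < γ) (hT : 0 < T) (c : ι)
    (ω : Fin T → A) (h : leader γ (fun c' => walk (g c') ω (stopTime g γ ω)) ≠ c) :
    1 ≤ (∑ c' ∈ Finset.univ.erase c, ∑ n ∈ Finset.range (T + 1), walk (g c') ω n / γ) +
      stepsBelow (g c) γ 1 ω / T := by
  have hT' : (0 : ℝ) < T := by exact_mod_cast hT
  have h0 : 0 ≤ ∑ c' ∈ Finset.univ.erase c, ∑ n ∈ Finset.range (T + 1), walk (g c') ω n / γ :=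
    Finset.sum_nonneg fun c' _ => Finset.sum_nonneg fun n _ =>
      div_nonneg (walk_nonneg (hg c') _ _) hγ.le
  by_cases hex : ∃ c', γ ≤ walk (g c') ω (stopTime g γ ω)
  · rw [leader, dif_pos hex] at h
    have hc := hex.choose_spec
    set c' := hex.choose
    have h1 : 1 ≤ walk (g c') ω (stopTime g γ ω) / γ := by rwa [one_le_div hγ]
    have h2 : walk (g c') ω (stopTime g γ ω) / γ ≤
        ∑ n ∈ Finset.range (T + 1), walk (g c') ω n / γ :=
      Finset.single_le_sum (f := fun n => walk (g c') ω n / γ)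
        (fun n _ => div_nonneg (walk_nonneg (hg c') _ _) hγ.le)
        (Finset.mem_range.2 (Nat.lt_succ_of_le (stopTime_le ω)))
    have h3 : ∑ n ∈ Finset.range (T + 1), walk (g c') ω n / γ ≤
        ∑ c' ∈ Finset.univ.erase c, ∑ n ∈ Finset.range (T + 1), walk (g c') ω n / γ :=
      Finset.single_le_sum
        (f := fun c' => ∑ n ∈ Finset.range (T + 1), walk (g c') ω n / γ)
        (fun c' _ => Finset.sum_nonneg fun n _ => div_nonneg (walk_nonneg (hg c') _ _) hγ.le)
        (Finset.mem_erase.2 ⟨h, Finset.mem_univ _⟩)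
    have h4 : (0 : ℝ) ≤ stepsBelow (g c) γ 1 ω / T := by positivity
    linarith
  · have h_stop : stopTime g γ ω = T :=
      ((stopTime_eq_iff (g := g) (γ := γ) (ω := ω)).1 rfl).1.resolve_right hex
    have h1 : (T : ℝ) ≤ stepsBelow (g c) γ 1 ω := by
      have := stopTime_le_stepsBelow (g := g) (γ := γ) c ω
      rw [h_stop] at this
      exact_mod_cast this
    have h2 : (1 : ℝ) ≤ stepsBelow (g c) γ 1 ω / T := by rwa [one_le_div hT']
    linarith

variable [Fintype A]

open Classical in
/-- The decoding error: the union bound over wrong candidates and times, each estimated by Markov's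
inequality, and Markov's inequality for the event that the horizon is reached. -/
lemma mean_leader_ne_le {w : A → ℝ} {κ L : ℝ} (hw : ∀ a, 0 ≤ w a) (hw1 : ∑ a, w a = 1)
    (hg : ∀ c a, 0 ≤ g c a) (hγ : 0 < γ) (hT : 0 < T) (c : ι)
    (hκ : ∀ c', c ≠ c' → ∑ a, w a * g c' a ≤ κ) (hκ1 : 1 ≤ κ)
    (hL : ∑ ω : Fin T → A, (∏ t, w (ω t)) * stepsBelow (g c) γ 1 ω ≤ L) :
    ∑ ω : Fin T → A, (∏ t, w (ω t)) *
      (if leader γ (fun c' => walk (g c') ω (stopTime g γ ω)) ≠ c then 1 else 0) ≤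
      Fintype.card ι * (T + 1) * κ ^ T / γ + L / T := by
  have hT' : (0 : ℝ) < T := by exact_mod_cast hT
  have hω (ω : Fin T → A) : 0 ≤ ∏ t, w (ω t) := Finset.prod_nonneg fun t _ => hw _
  calc _ ≤ ∑ ω : Fin T → A, (∏ t, w (ω t)) *
        ((∑ c' ∈ Finset.univ.erase c, ∑ n ∈ Finset.range (T + 1), walk (g c') ω n / γ) +
          stepsBelow (g c) γ 1 ω / T) := by
        refine Finset.sum_le_sum fun ω _ => mul_le_mul_of_nonneg_left ?_ (hω ω)
        split_ifs with h
        · exact one_le_of_leader_ne hg hγ hT c ω h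
        · exact add_nonneg (Finset.sum_nonneg fun c' _ => Finset.sum_nonneg fun n _ =>
            div_nonneg (walk_nonneg (hg c') _ _) hγ.le) (by positivity)
    _ = (∑ c' ∈ Finset.univ.erase c, ∑ n ∈ Finset.range (T + 1),
          (∑ ω : Fin T → A, (∏ t, w (ω t)) * walk (g c') ω n) / γ) +
        (∑ ω : Fin T → A, (∏ t, w (ω t)) * stepsBelow (g c) γ 1 ω) / T := by
        simp only [mul_add, Finset.sum_add_distrib, Finset.mul_sum, Finset.sum_div, mul_div_assoc]
        congr 1
        rw [Finset.sum_comm]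
        refine Finset.sum_congr rfl fun c' _ => ?_
        rw [Finset.sum_comm]
    _ ≤ (∑ c' ∈ Finset.univ.erase c, ∑ n ∈ Finset.range (T + 1), κ ^ T / γ) + L / T := by
        gcongr with c' hc' n hn
        exact mean_walk_le hw hw1 (hg c') (hκ c' (Finset.ne_of_mem_erase hc').symm) hκ1 n
    _ ≤ (∑ c' : ι, ∑ n ∈ Finset.range (T + 1), κ ^ T / γ) + L / T := by
        have hκ0 : 0 ≤ κ := zero_le_one.trans hκ1
        exact add_le_add (Finset.sum_le_sum_of_subset_of_nonneg (Finset.subset_univ _)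
          fun c' _ _ => Finset.sum_nonneg fun n _ => by positivity) le_rfl
    _ = _ := by
        simp only [Finset.sum_const, Finset.card_univ, Finset.card_range, nsmul_eq_mul]
        push_cast
        ring

end Decoder

/-! ### The query procedure -/

section Procedure

variable {𝒴 : Type*} {d m T : ℕ}

/-- The player's randomness: `none`, by which the player gives up without any query, or a sequence
of permutations of the grid cells, one for every query up to the horizon `T`. -/
abbrev Codebook (d m T : ℕ) : Type := Option (Fin T → Equiv.Perm (Fin (m ^ d)))

instance : MeasurableSpace (Codebook d m T) := ⊤

instance : DiscreteMeasurableSpace (Codebook d m T) := ⟨fun _ => trivial⟩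

/-- The codebook is a uniform sequence of permutations with probability `lam`, and `none` with
probability `1 - lam`. -/
def codebookLaw (d m T : ℕ) (lam : ℝ) : Measure (Codebook d m T) :=
  ENNReal.ofReal (1 - lam) • Measure.dirac none + ENNReal.ofReal lam •
    ∑ σ : Fin T → Equiv.Perm (Fin (m ^ d)),
      ENNReal.ofReal (∏ _t : Fin T, (Fintype.card (Equiv.Perm (Fin (m ^ d))) : ℝ)⁻¹) •
        Measure.dirac (some σ)

lemma lintegral_codebookLaw (lam : ℝ) (F : Codebook d m T → ℝ≥0∞) :
    ∫⁻ u, F u ∂codebookLaw d m T lam = ENNReal.ofReal (1 - lam) * F none + ENNReal.ofReal lam *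
      ∑ σ : Fin T → Equiv.Perm (Fin (m ^ d)),
        ENNReal.ofReal (∏ _t : Fin T, (Fintype.card (Equiv.Perm (Fin (m ^ d))) : ℝ)⁻¹) *
          F (some σ) := by
  simp [codebookLaw, lintegral_add_measure, lintegral_smul_measure, lintegral_finsetSum_measure]

lemma isProbabilityMeasure_codebookLaw {lam : ℝ} (h : lam ∈ Set.Icc (0 : ℝ) 1) :
    IsProbabilityMeasure (codebookLaw d m T lam) := by
  constructor
  rw [← lintegral_one, lintegral_codebookLaw]
  simp only [mul_one]
  have h1 := sum_prod_weight (T := T)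
    (fun _ : Equiv.Perm (Fin (m ^ d)) => (Fintype.card (Equiv.Perm (Fin (m ^ d))) : ℝ)⁻¹) (by simp)
  rw [← ENNReal.ofReal_sum_of_nonneg fun σ _ => by positivity, h1, ENNReal.ofReal_one, mul_one,
    ← ENNReal.ofReal_add (by linarith [h.2]) h.1]
  simp

/-- The permutation used for query `n`. -/
def Codebook.perm : Codebook d m T → ℕ → Equiv.Perm (Fin (m ^ d))
  | none, _ => 1
  | some σ, n => if h : n < T then σ ⟨n, h⟩ else 1

variable [MeasurableSpace 𝒴] [Fintype 𝒴] [DiscreteMeasurableSpace 𝒴]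

/-- The record of the permutations and responses up to the horizon `T`. -/
def record (σ : Fin T → Equiv.Perm (Fin (m ^ d))) (y : ℕ → 𝒴) :
    Fin T → Equiv.Perm (Fin (m ^ d)) × 𝒴 := fun t => (σ t, y t)

/-- Random coding with stop-feedback for the channel in the state `v`, with queries of size `q`:
query `n` is `gridQuery i₀ q (u.perm n)`, whatever the responses are; the player stops when the
likelihood ratio of some cell of the grid has reached `γ`, or at the horizon `T`, and returns a
corner of that cell. The response `y₀` only serves to extend finite response sequences. -/
def gridProcedure [NeZero m] (W : ℝ → Bool → PMF 𝒴) (i₀ : Fin d) (y₀ : 𝒴) (T : ℕ) (q v γ : ℝ)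
    {lam : ℝ} (hlam : lam ∈ Set.Icc (0 : ℝ) 1) : QueryProcedure 𝒴 d where
  Ω := Codebook d m T
  P := codebookLaw d m T lam
  isProb := isProbabilityMeasure_codebookLaw hlam
  query u n _ := gridQuery i₀ q (u.perm n)
  query_subset _ _ _ := gridQuery_subset_cube
  query_meas _ _ _ := measurableSet_gridQuery.nullMeasurableSet
  query_joint_meas n _ := by
    refine MeasurableSet.nullMeasurableSet ?_
    have : {p : Codebook d m T × (Fin d → ℝ) | p.2 ∈ gridQuery i₀ q (p.1.perm n)} =
        ⋃ u : Codebook d m T, {u} ×ˢ gridQuery i₀ q (u.perm n) := by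
      ext ⟨u, s⟩
      simp
    rw [this]
    exact MeasurableSet.iUnion fun u => (MeasurableSet.of_discrete).prod measurableSet_gridQuery
  decode u n h := Option.elim u (corner (default : Fin (m ^ d))) fun σ =>
    corner (leader γ fun c => walk (stepMetric W q v c)
      (record σ fun k => if hk : k < n then h ⟨k, hk⟩ else y₀) n)
  decode_mem u _ _ := by cases u <;> exact corner_mem_cube
  decode_meas _ _ := measurable_from_top
  τ u y := u.elim 0 fun σ =>
    (stopTime (fun c : Fin (m ^ d) => stepMetric W q v c) γ (record σ y) : ℕ∞)
  τ_stopping u n y y' h := by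
    cases u with
    | none => exact id
    | some σ =>
      simp only [Option.elim, Nat.cast_inj]
      exact stopTime_congr fun t ht => by simp [record, h t ht]
  τ_meas := by
    refine measurable_from_prod_countable_right fun u => ?_
    cases u with
    | none => exact measurable_const
    | some σ =>
      have hr : Measurable fun (y : ℕ → 𝒴) (t : Fin T) => y t := by fun_prop
      exact (measurable_of_finite fun y : Fin T → 𝒴 =>
        (stopTime (fun c : Fin (m ^ d) => stepMetric W q v c) γ fun t => (σ t, y t) : ℕ∞)).comp hr

variable [NeZero m] {W : ℝ → Bool → PMF 𝒴} {f : ℝ → ℝ} {i₀ : Fin d} {y₀ : 𝒴} {q γ lam : ℝ}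
  {hlam : lam ∈ Set.Icc (0 : ℝ) 1} {s : Fin d → ℝ} {c : Fin (m ^ d)}

lemma response_gridProcedure (hq : q ∈ Set.Icc (0 : ℝ) 1) (hs : s ∈ slab i₀ c 1)
    (u : Codebook d m T) (n : ℕ) (h : Fin n → 𝒴) :
    (gridProcedure (m := m) W i₀ y₀ T q (f q) γ hlam).response W f u s n h =
      W (f q) (targetBit i₀ q c s (u.perm n c)) := by
  have hv : volume (gridQuery i₀ q (u.perm n)) = ENNReal.ofReal q :=
    volume_gridQuery (NeZero.pos m) hq.1 hq.2
  unfold QueryProcedure.response targetBit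
  congr 1
  · simp only [gridProcedure]
    rw [hv, ENNReal.toReal_ofReal hq.1]
  · simp only [gridProcedure]
    exact decide_eq_decide.2 (mem_gridQuery hs)

/-- Averages over the codebook and the responses are averages over i.i.d. steps. -/
lemma lintegral_gridProcedure (hq : q ∈ Set.Icc (0 : ℝ) 1) (hs : s ∈ slab i₀ c 1)
    (F : Codebook d m T → (ℕ → 𝒴) → ℝ≥0∞) (G : (Fin T → Equiv.Perm (Fin (m ^ d)) × 𝒴) → ℝ)
    (hG : ∀ ω, 0 ≤ G ω) (hF : ∀ σ y, F (some σ) y = ENNReal.ofReal (G (record σ y))) :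
    ∫⁻ u, ∫⁻ y, F u y
        ∂(gridProcedure (m := m) W i₀ y₀ T q (f q) γ hlam).responseLaw W f u s
        ∂codebookLaw d m T lam =
      ENNReal.ofReal (1 - lam) * ∫⁻ y, F none y
        ∂(gridProcedure (m := m) W i₀ y₀ T q (f q) γ hlam).responseLaw W f
          (none : Codebook d m T) s +
      ENNReal.ofReal lam * ENNReal.ofReal (∑ ω : Fin T → Equiv.Perm (Fin (m ^ d)) × 𝒴,
        (∏ t, stepWeight W (f q) (targetBit i₀ q c s) c (ω t)) * G ω) := by
  rw [lintegral_codebookLaw]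
  congr 2
  rw [ENNReal.ofReal_sum_of_nonneg fun ω _ =>
      mul_nonneg (Finset.prod_nonneg fun t _ => stepWeight_nonneg _) (hG ω),
    ← (Equiv.arrowProdEquivProdArrow (Fin T) (fun _ => Equiv.Perm (Fin (m ^ d)))
      fun _ => 𝒴).symm.sum_comp, Fintype.sum_prod_type]
  refine Finset.sum_congr rfl fun σ _ => ?_
  simp only [hF]
  refine (congrArg _ (lintegral_responseLaw (fun n => W (f q)
      (targetBit i₀ q c s (Codebook.perm (some σ : Codebook d m T) n c)))
    (fun n h => response_gridProcedure hq hs (some σ) n h)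
    (fun y : Fin T → 𝒴 => ENNReal.ofReal (G fun t => (σ t, y t))))).trans ?_
  rw [Finset.mul_sum]
  refine Finset.sum_congr rfl fun y _ => ?_
  have h1 : ∏ t : Fin T, W (f q)
      (targetBit i₀ q c s (Codebook.perm (some σ : Codebook d m T) t c)) (y t) =
      ENNReal.ofReal (∏ t : Fin T, (W (f q) (targetBit i₀ q c s (σ t c)) (y t)).toReal) := by
    rw [ENNReal.ofReal_prod_of_nonneg fun t _ => ENNReal.toReal_nonneg]
    refine Finset.prod_congr rfl fun t _ => ?_
    rw [ENNReal.ofReal_toReal (PMF.apply_ne_top _ _)]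
    simp [Codebook.perm]
  rw [h1, ← mul_assoc, ← ENNReal.ofReal_mul (by positivity), ← Finset.prod_mul_distrib,
    ← ENNReal.ofReal_mul (Finset.prod_nonneg fun t _ => mul_nonneg (by positivity)
      ENNReal.toReal_nonneg)]
  rfl

variable (W f) in
/-- The step metrics of the grid cells, for the channel in the state `f q`. -/
abbrev gridMetric (d m : ℕ) (q : ℝ) (c : Fin (m ^ d)) : Equiv.Perm (Fin (m ^ d)) × 𝒴 → ℝ :=
  stepMetric W q (f q) c

lemma excessEvent_gridProcedure_subset (hs : s ∈ slab i₀ c 1)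
    (σ : Fin T → Equiv.Perm (Fin (m ^ d))) :
    (gridProcedure (m := m) W i₀ y₀ T q (f q) γ hlam).excessEvent (1 / m)
      (some σ : Codebook d m T) s ⊆
    {y | leader γ (fun c' => walk (gridMetric W f d m q c') (record σ y)
      (stopTime (gridMetric W f d m q) γ (record σ y))) ≠ c} := by
  rintro y ⟨n, hn, i, hi⟩ hy
  have hn' : stopTime (gridMetric W f d m q) γ (record σ y) = n := by
    simpa [gridProcedure] using hn
  rw [hn'] at hy
  have hdec : (gridProcedure (m := m) W i₀ y₀ T q (f q) γ hlam).decode (some σ : Codebook d m T) n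
      (fun j => y j) = corner c := by
    rw [← hy]
    simp only [gridProcedure, Option.elim]
    congr 2
    funext c'
    exact walk_congr _ fun t ht => by simp [record, ht]
  rw [hdec] at hi
  exact absurd (abs_corner_sub_le hs i) (not_le.2 hi)

/-- The performance of the random code: with the threshold `γ` and the horizon `T`, the mean number
of queries is governed by the time at which the likelihood ratio of the true cell reaches `γ`, and
the error probability by the union bound over wrong cells and times. -/
lemma isAdaptive_gridProcedure (hq : q ∈ Set.Ioo (0 : ℝ) 1) (hγ : 1 < γ) (hT : 0 < T)
    (hM : 1 < m ^ d) {κ L : ℝ} (hκ : 0 < κ)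
    (hκW : κ ≤ meanInfoDensity W q (f q) - (|drift W q (f q) (some true)| +
      |drift W q (f q) (some false)|) / (m ^ d : ℕ))
    (hL : Real.log (γ * (1 / q + 1 / (1 - q))) ≤ κ * L) :
    (gridProcedure (m := m) W i₀ y₀ T q (f q) γ hlam).IsAdaptive W f (lam * L) (1 / m)
      ((1 - lam) + lam * ((m ^ d : ℕ) * (T + 1) *
        (((m ^ d : ℕ) + 1 : ℝ) / ((m ^ d : ℕ) - 1)) ^ T / γ + L / T)) := by
  classical
  have hq' : q ∈ Set.Icc (0 : ℝ) 1 := ⟨hq.1.le, hq.2.le⟩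
  have hγ0 : 0 < γ := zero_lt_one.trans hγ
  have hB1 : 1 ≤ 1 / q + 1 / (1 - q) := by
    have h1 : 1 ≤ 1 / q := by rw [le_div_iff₀ hq.1]; linarith [hq.2]
    have h2 : 0 < 1 / (1 - q) := one_div_pos.2 (by linarith [hq.2])
    linarith
  have hM' : (1 : ℝ) < (m ^ d : ℕ) := by exact_mod_cast hM
  have hL0 : 0 ≤ L := by
    refine nonneg_of_mul_nonneg_right ((Real.log_nonneg ?_).trans hL) hκ
    nlinarith
  have hg (c : Fin (m ^ d)) (a) : 0 ≤ gridMetric W f d m q c a := metric_nonneg hq _ _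
  have hbelow (s : Fin d → ℝ) (c : Fin (m ^ d)) (hs : s ∈ slab i₀ c 1) :
      ∑ ω : Fin T → Equiv.Perm (Fin (m ^ d)) × 𝒴,
        (∏ t, stepWeight W (f q) (targetBit i₀ q c s) c (ω t)) *
          stepsBelow (gridMetric W f d m q c) γ 1 ω ≤ L := by
    refine le_of_mul_le_mul_left ((mean_stepsBelow_le (B := 1 / q + 1 / (1 - q))
      stepWeight_nonneg sum_stepWeight (stepMetric_pos hq (targetBit_eq hs))
      (fun a => metric_le hq _ _)
      (hκW.trans (le_sum_stepWeight_mul_log hq' (targetBit_eq hs))) hγ0 1 zero_lt_one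
      (by nlinarith)).trans ?_) hκ
    rw [Real.log_one, sub_zero]
    exact hL
  constructor
  · intro g hgpdf
    refine lintegral_targetLaw_le hgpdf fun s h0 h1 => ?_
    obtain ⟨c, hs⟩ := exists_mem_slab (NeZero.pos m) i₀ h0 h1
    refine (lintegral_gridProcedure hq' hs _
      (fun ω => (stopTime (gridMetric W f d m q) γ ω : ℝ)) (fun ω => Nat.cast_nonneg _)
      (fun σ y => ?_)).le.trans ?_
    · simp [gridProcedure]
    · have h0 : ∫⁻ y, ((gridProcedure (m := m) W i₀ y₀ T q (f q) γ hlam).τ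
          (none : Codebook d m T) y : ℝ≥0∞)
          ∂(gridProcedure (m := m) W i₀ y₀ T q (f q) γ hlam).responseLaw W f
          (none : Codebook d m T) s = 0 := by
        simp [gridProcedure]
      rw [h0, mul_zero, zero_add, ← ENNReal.ofReal_mul hlam.1]
      refine ENNReal.ofReal_le_ofReal (mul_le_mul_of_nonneg_left ?_ hlam.1)
      refine (Finset.sum_le_sum fun ω _ => mul_le_mul_of_nonneg_left ?_
        (Finset.prod_nonneg fun t _ => stepWeight_nonneg _)).trans (hbelow s c hs)
      exact_mod_cast stopTime_le_stepsBelow c ω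
  · refine iSup₂_le fun g hgpdf => lintegral_targetLaw_le hgpdf fun s h0 h1 => ?_
    obtain ⟨c, hs⟩ := exists_mem_slab (NeZero.pos m) i₀ h0 h1
    set π := gridProcedure (m := m) W i₀ y₀ T q (f q) γ hlam
    let G : (Fin T → Equiv.Perm (Fin (m ^ d)) × 𝒴) → ℝ := fun ω =>
      if leader γ (fun c' => walk (gridMetric W f d m q c') ω
        (stopTime (gridMetric W f d m q) γ ω)) ≠ c then 1 else 0
    have hG : ∀ ω, 0 ≤ G ω := fun ω => by simp only [G]; split_ifs <;> simp
    let F : Codebook d m T → (ℕ → 𝒴) → ℝ≥0∞ := fun u y =>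
      u.elim 1 fun σ => ENNReal.ofReal (G (record σ y))
    have hprob : IsProbabilityMeasure (π.responseLaw W f (none : Codebook d m T) s) :=
      isProbabilityMeasure_responseLaw
    have hF : ∀ u : Codebook d m T, π.responseLaw W f u s (π.excessEvent (1 / m) u s) ≤
        ∫⁻ y, F u y ∂π.responseLaw W f u s := by
      intro u
      cases u with
      | none =>
        simp only [F, Option.elim, lintegral_one, measure_univ]
        exact prob_le_one
      | some σ =>
        refine (measure_mono (excessEvent_gridProcedure_subset hs σ)).trans ?_
        refine (meas_le_lintegral₀ ?_ fun y hy => ?_)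
        · have hr : Measurable fun (y : ℕ → 𝒴) (t : Fin T) => y t := by fun_prop
          exact ((measurable_of_finite fun y : Fin T → 𝒴 =>
            ENNReal.ofReal (G fun t => (σ t, y t))).comp hr).aemeasurable
        · simp only [Set.mem_ofPred_eq] at hy
          simp [F, G, hy]
    refine (lintegral_mono hF).trans ?_
    refine (lintegral_gridProcedure hq' hs F G hG fun σ y => rfl).le.trans ?_
    have hnone : ∫⁻ y, F none y ∂π.responseLaw W f (none : Codebook d m T) s ≤ 1 := by
      simp [F]
    have hκ1 : (1 : ℝ) ≤ ((m ^ d : ℕ) + 1 : ℝ) / ((m ^ d : ℕ) - 1) := by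
      rw [le_div_iff₀ (by linarith)]
      linarith
    have herr := mean_leader_ne_le (T := T) stepWeight_nonneg sum_stepWeight hg hγ0 hT c
      (fun c' hcc => sum_stepWeight_mul_stepMetric_le hq hcc) hκ1 (hbelow s c hs)
    rw [Fintype.card_fin] at herr
    have hE : 0 ≤ (m ^ d : ℕ) * (T + 1) *
        (((m ^ d : ℕ) + 1 : ℝ) / ((m ^ d : ℕ) - 1)) ^ T / γ + L / T := by
      have : (0 : ℝ) ≤ ((m ^ d : ℕ) + 1 : ℝ) / ((m ^ d : ℕ) - 1) := by linarith
      positivity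
    rw [ENNReal.ofReal_add (by linarith [hlam.2]) (mul_nonneg hlam.1 hE),
      ENNReal.ofReal_mul hlam.1]
    gcongr
    · exact mul_le_of_le_one_right' hnone

end Procedure

/-! ### Choice of the parameters -/

section Asymptotics

lemma eventually_log_le_linear {A : ℝ} (hA : 0 < A) (Q R : ℝ) :
    ∀ᶠ l : ℝ in atTop, Q * Real.log l + R ≤ A * l := by
  have h : (fun l : ℝ => Q * Real.log l + R) =o[atTop] (id : ℝ → ℝ) :=
    (Real.isLittleO_log_id_atTop.const_mul_left Q).add
      (Asymptotics.isLittleO_const_id_atTop R)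
  filter_upwards [h.bound hA, eventually_ge_atTop 0] with l hl hl0
  refine (le_abs_self _).trans (hl.trans_eq ?_)
  simp [abs_of_nonneg hl0]

variable {𝒴 : Type*} [Fintype 𝒴] [MeasurableSpace 𝒴] [DiscreteMeasurableSpace 𝒴]
  {W : ℝ → Bool → PMF 𝒴} {f : ℝ → ℝ} {d : ℕ}

/-- The code on a grid with `M` cells, with the threshold `6 e² M l^(2 k + 2)` and the horizon
`l^(k + 2)`, makes at most `l` queries on average and has an error probability of at most `l^(-k)`,
as long as `log M` stays below `l C` by a logarithmic margin. -/
lemma exists_isAdaptive_of_grid [Nonempty 𝒴] {q : ℝ} (hq : q ∈ Set.Ioo (0 : ℝ) 1) (hd : 1 ≤ d)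
    {k : ℝ} (hk : 0 < k) {D l lam : ℝ}
    (hD : D = |drift W q (f q) (some true)| + |drift W q (f q) (some false)|)
    (hlam : lam ∈ Set.Icc (0 : ℝ) 1) (hl : 2 ≤ l) (hDl : D / l < meanInfoDensity W q (f q))
    {m : ℕ} (hm : 3 * l ^ (k + 2) ≤ m)
    (hm' : d * Real.log m ≤ l * meanInfoDensity W q (f q) - (2 * k + 2) * Real.log l -
      (Real.log (6 * Real.exp 2 * (1 / q + 1 / (1 - q))) + D)) :
    ∃ π : QueryProcedure 𝒴 d, π.IsAdaptive W f (lam * l) (1 / m)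
      ((1 - lam) + lam * l ^ (-k)) := by
  obtain ⟨y₀⟩ := ‹Nonempty 𝒴›
  have hl0 : 0 < l := by linarith
  have hD0 : 0 ≤ D := by rw [hD]; positivity
  have hB : 0 < 1 / q + 1 / (1 - q) := by
    have := hq.1
    have : 0 < 1 - q := by linarith [hq.2]
    positivity
  have hpow : l ≤ l ^ (k + 2) := by
    simpa using Real.rpow_le_rpow_of_exponent_le (by linarith : 1 ≤ l) (by linarith : 1 ≤ k + 2)
  have hm0 : 0 < m := by
    have : (0 : ℝ) < m := by linarith
    exact_mod_cast this
  have : NeZero m := ⟨hm0.ne'⟩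
  set M : ℝ := ((m ^ d : ℕ) : ℝ) with hMdef
  have hmM : (m : ℝ) ≤ M := by
    rw [hMdef]
    exact_mod_cast Nat.le_self_pow (by omega) m
  have hM0 : 0 < M := by linarith
  have hM1 : 1 < m ^ d := by
    have : (1 : ℝ) < ((m ^ d : ℕ) : ℝ) := by linarith
    exact_mod_cast this
  have hlogM : Real.log M = d * Real.log m := by
    rw [hMdef]; push_cast; exact Real.log_pow _ _
  set T := ⌈l ^ (k + 2)⌉₊ with hT
  have hTge : l ^ (k + 2) ≤ T := Nat.le_ceil _
  have hTle : (T : ℝ) + 1 ≤ 3 * l ^ (k + 2) := by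
    have := (Nat.ceil_lt_add_one (by positivity : 0 ≤ l ^ (k + 2))).le
    linarith
  have hT0 : 0 < T := Nat.ceil_pos.2 (by positivity)
  have hT0' : (0 : ℝ) < T := by exact_mod_cast hT0
  set γ : ℝ := 6 * Real.exp 2 * M * l ^ (2 * k + 2) with hγ
  have he : 1 ≤ Real.exp 2 := Real.one_le_exp (by norm_num)
  have hlpos : 1 ≤ l ^ (2 * k + 2) := Real.one_le_rpow (by linarith) (by linarith)
  have hγ1 : 1 < γ := by
    rw [hγ]
    have h1 : 1 ≤ Real.exp 2 * l ^ (2 * k + 2) := by nlinarith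
    have h2 : 1 < M := by linarith
    nlinarith
  have hDM : D / M ≤ D / l := by gcongr; linarith
  have hlDM : l * (D / M) ≤ D := by
    rw [mul_div_assoc', div_le_iff₀ hM0, mul_comm]
    exact mul_le_mul_of_nonneg_left (by linarith) hD0
  have hκ : 0 < meanInfoDensity W q (f q) - D / M := by linarith
  have hL : Real.log (γ * (1 / q + 1 / (1 - q))) ≤ (meanInfoDensity W q (f q) - D / M) * l := by
    have : γ * (1 / q + 1 / (1 - q)) =
        (6 * Real.exp 2 * (1 / q + 1 / (1 - q))) * M * l ^ (2 * k + 2) := by rw [hγ]; ring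
    rw [this, Real.log_mul (by positivity) (by positivity), Real.log_mul (by positivity) hM0.ne',
      Real.log_rpow hl0, hlogM]
    linarith
  have hmain := isAdaptive_gridProcedure (m := m) (T := T) (i₀ := ⟨0, hd⟩) (y₀ := y₀)
    (hlam := hlam) hq hγ1 hT0 hM1 hκ (by rw [hD]) hL
  refine ⟨_, hmain.1, hmain.2.trans (ENNReal.ofReal_le_ofReal ?_)⟩
  refine add_le_add le_rfl (mul_le_mul_of_nonneg_left ?_ hlam.1)
  -- The horizon is at most `M - 1`, so the excess growth of wrong cells is at most `e²` in total.
  have hpowT : ((M + 1) / (M - 1)) ^ T ≤ Real.exp 2 := by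
    have hM1' : 0 < M - 1 := by linarith
    have h1 : (M + 1) / (M - 1) ≤ Real.exp (2 / (M - 1)) := by
      have : (M + 1) / (M - 1) = 2 / (M - 1) + 1 := by field_simp; ring
      rw [this]
      exact Real.add_one_le_exp _
    calc _ ≤ Real.exp (2 / (M - 1)) ^ T := by gcongr
      _ = Real.exp (T * (2 / (M - 1))) := (Real.exp_nat_mul _ _).symm
      _ ≤ Real.exp 2 := by
        refine Real.exp_le_exp.2 ?_
        rw [mul_div_assoc', div_le_iff₀ hM1']
        nlinarith
  have hsplit1 : l ^ (2 * k + 2) = l ^ (k + 2) * l ^ k := by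
    rw [← Real.rpow_add hl0]; congr 1; ring
  have hsplit2 : l ^ (k + 2) = l ^ k * l * l := by
    rw [Real.rpow_add hl0, Real.rpow_two]; ring
  have hlk : 0 < l ^ k := by positivity
  have e1 : M * (T + 1) * ((M + 1) / (M - 1)) ^ T / γ ≤ l ^ (-k) / 2 := by
    have hM1' : 0 < M - 1 := by linarith
    calc _ ≤ M * (3 * l ^ (k + 2)) * Real.exp 2 / γ := by gcongr
      _ = l ^ (-k) / 2 := by
        rw [hγ, hsplit1, Real.rpow_neg hl0.le]
        field_simp
        norm_num
  have e2 : l / T ≤ l ^ (-k) / 2 := by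
    calc l / T ≤ l / l ^ (k + 2) := by gcongr
      _ = l ^ (-k) / l := by
        rw [hsplit2, Real.rpow_neg hl0.le]
        field_simp
      _ ≤ l ^ (-k) / 2 := by gcongr
  linarith

/-- Achievability with polynomially small error: for a positive mean information density `C`, a
resolution `1 / m` with `log m = l C / d - O(log l)` is reached with `l` queries on average. The
player gives up with probability `1 - lam`, which reduces the number of queries in proportion. -/
lemma exists_isAdaptive [Nonempty 𝒴] {q : ℝ} (hq : q ∈ Set.Ioo (0 : ℝ) 1) (hd : 1 ≤ d)
    (hC : 0 < meanInfoDensity W q (f q)) {k : ℝ} (hk : 0 < k) :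
    ∃ b : ℝ, ∀ᶠ l : ℝ in atTop, ∀ lam ∈ Set.Icc (0 : ℝ) 1, ∃ m : ℕ, 0 < m ∧
      l * meanInfoDensity W q (f q) / d - (2 * k + 2) / d * Real.log l - b ≤ Real.log m ∧
      ∃ π : QueryProcedure 𝒴 d, π.IsAdaptive W f (lam * l) (1 / m)
        ((1 - lam) + lam * l ^ (-k)) := by
  set C := meanInfoDensity W q (f q) with hCdef
  set D := |drift W q (f q) (some true)| + |drift W q (f q) (some false)| with hD
  set c := Real.log (6 * Real.exp 2 * (1 / q + 1 / (1 - q))) + D with hc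
  have hd0 : (0 : ℝ) < d := by exact_mod_cast hd
  refine ⟨c / d + Real.log 2, ?_⟩
  filter_upwards [eventually_ge_atTop 2, eventually_gt_atTop (D / C),
    eventually_log_le_linear (div_pos hC hd0) ((2 * k + 2) / d + (k + 2))
      (c / d + Real.log 6)] with l hl2 hlD hlog lam hlam
  have hl0 : 0 < l := by linarith
  set x := (l * C - (2 * k + 2) * Real.log l - c) / d with hx
  have hxe : x = l * C / d - (2 * k + 2) / d * Real.log l - c / d := by rw [hx]; ring
  have hx6 : Real.log 6 + (k + 2) * Real.log l ≤ x := by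
    have : C / d * l = l * C / d := by ring
    rw [hxe]
    linarith
  have hexp : 6 * l ^ (k + 2) ≤ Real.exp x := by
    rw [← Real.exp_log (by norm_num : (0 : ℝ) < 6), Real.rpow_def_of_pos hl0, ← Real.exp_add,
      mul_comm (Real.log l)]
    exact Real.exp_le_exp.2 hx6
  have hl1 : 1 ≤ l ^ (k + 2) := Real.one_le_rpow (by linarith) (by linarith)
  have hfloor : Real.exp x / 2 ≤ ⌊Real.exp x⌋₊ := by
    have := Nat.lt_floor_add_one (Real.exp x)
    linarith
  have hm0 : (0 : ℝ) < ⌊Real.exp x⌋₊ := by linarith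
  refine ⟨⌊Real.exp x⌋₊, by exact_mod_cast hm0, ?_, ?_⟩
  · have h1 := Real.log_le_log (by positivity) hfloor
    rw [Real.log_div (Real.exp_pos x).ne' two_ne_zero, Real.log_exp] at h1
    linarith
  · refine exists_isAdaptive_of_grid hq hd hk hD hlam hl2 ?_ (by linarith) ?_
    · rwa [div_lt_iff₀ hl0, mul_comm, ← div_lt_iff₀ hC]
    · have h1 := Real.log_le_log hm0 (Nat.floor_le (Real.exp_pos x).le)
      rw [Real.log_exp, hx, le_div_iff₀ hd0, mul_comm] at h1
      linarith

/-! ### From procedures to the optimal resolution -/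

lemma QueryProcedure.IsAdaptive.mono {π : QueryProcedure 𝒴 d} {l l' δ ε ε' : ℝ}
    (h : π.IsAdaptive W f l δ ε) (hl : l ≤ l') (hε : ε ≤ ε') : π.IsAdaptive W f l' δ ε' :=
  ⟨fun g hg => (h.1 g hg).trans (ENNReal.ofReal_le_ofReal hl),
    h.2.trans (ENNReal.ofReal_le_ofReal hε)⟩

lemma log_le_neg_log_optResolution {π : QueryProcedure 𝒴 d} {l ε : ℝ} {m : ℕ} (hm : 0 < m)
    (h : π.IsAdaptive W f l (1 / m) ε) :
    ((Real.log m : ℝ) : EReal) ≤ -ENNReal.log (optResolution W f l d ε) := by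
  have hm' : (0 : ℝ) < 1 / m := by positivity
  have h1 : optResolution W f l d ε ≤ ENNReal.ofReal (1 / m) :=
    iInf_le_of_le (1 / m : ℝ) (iInf_le_of_le hm' (iInf_le_of_le ⟨π, h⟩ le_rfl))
  have h2 := ENNReal.log_monotone h1
  rw [ENNReal.log_ofReal_of_pos hm'] at h2
  rw [EReal.le_neg]
  refine h2.trans_eq ?_
  rw [one_div, Real.log_inv, EReal.coe_neg]

/-- No query at all is needed for the resolution `1`. -/
lemma zero_le_neg_log_optResolution (l ε : ℝ) :
    (0 : EReal) ≤ -ENNReal.log (optResolution W f l d ε) := by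
  let π : QueryProcedure 𝒴 d :=
    { Ω := Unit
      P := Measure.dirac ()
      query := fun _ _ _ => ∅
      query_subset := fun _ _ _ => Set.empty_subset _
      query_meas := fun _ _ _ => MeasurableSet.empty.nullMeasurableSet
      query_joint_meas := fun _ _ => by simp
      decode := fun _ _ _ => 0
      decode_mem := fun _ _ _ => ⟨le_rfl, zero_le_one⟩
      decode_meas := fun _ _ => measurable_const
      τ := fun _ _ => 0
      τ_stopping := fun _ _ _ _ _ => id
      τ_meas := measurable_const }
  have h : π.IsAdaptive W f l (1 / (1 : ℕ)) ε := by
    refine ⟨fun g hg => ?_, iSup₂_le fun g hg => lintegral_targetLaw_le hg fun s h0 h1 => ?_⟩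
    · simp [QueryProcedure.meanQueries, π]
    · have hempty (u : π.Ω) : π.excessEvent (1 / (1 : ℕ)) u s = ∅ := by
        refine Set.eq_empty_of_forall_notMem fun y hy => ?_
        obtain ⟨n, -, i, hi⟩ := hy
        simp only [π, Pi.zero_apply, zero_sub, abs_neg, abs_of_nonneg (h0 i)] at hi
        norm_num at hi
        linarith [h1 i]
      simp only [hempty, measure_empty, lintegral_zero, zero_le]
  simpa using log_le_neg_log_optResolution one_pos h

/-- A lower bound that holds for large arguments up to a logarithmic term, together with
nonnegativity, is a lower bound for all arguments up to a remainder of logarithmic order. -/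
lemma exists_isBigO_log {Φ : ℝ → EReal} {S a b : ℝ} (h0 : ∀ l, 0 ≤ Φ l)
    (h : ∀ᶠ l : ℝ in atTop, ((l * S - a * Real.log l - b : ℝ) : EReal) ≤ Φ l) :
    ∃ r : ℝ → ℝ, r =O[atTop] Real.log ∧ ∀ l, ((l * S + r l : ℝ) : EReal) ≤ Φ l := by
  obtain ⟨l₀, hl₀⟩ := eventually_atTop.1 h
  classical
  refine ⟨fun l => if l₀ ≤ l then -(a * Real.log l) - b else -(l * S), ?_, fun l => ?_⟩
  · have h1 : (fun l : ℝ => -(a * Real.log l) - b) =O[atTop] Real.log := by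
      refine (((Asymptotics.isBigO_refl _ _).const_mul_left a).neg_left).sub ?_
      exact (Real.isLittleO_const_log_atTop).isBigO
    refine h1.congr' ?_ EventuallyEq.rfl
    filter_upwards [eventually_ge_atTop l₀] with l hl
    rw [if_pos hl]
  · by_cases hl : l₀ ≤ l
    · have := hl₀ l hl
      simp only [if_pos hl]
      convert this using 2
      ring
    · simpa only [if_neg hl, add_neg_cancel, EReal.coe_zero] using h0 l

end Asymptotics

end

end TwentyQuestions

open TwentyQuestions in
theorem theorem2 {𝒴 : Type*} [Fintype 𝒴] [MeasurableSpace 𝒴] [DiscreteMeasurableSpace 𝒴]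
    (W : ℝ → Bool → PMF 𝒴) (hWmeas : ∀ (x : Bool) (y : 𝒴), Measurable fun q => W q x y)
    (hWcont : IsContinuousChannel W)
    (f : ℝ → ℝ) (K : ℝ≥0) (hfLip : LipschitzOnWith K f (Set.Icc 0 1))
    (hfnonneg : ∀ q ∈ Set.Icc (0 : ℝ) 1, 0 ≤ f q)
    (C : ℝ) (hC : IsCapacity W f C) (d : ℕ) (hd : 1 ≤ d) :
    (∀ ε ∈ Set.Ioo (0 : ℝ) 1, ∃ r : ℝ → ℝ, r =O[atTop] Real.log ∧
      ∀ l : ℝ, 0 < l →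
        ((l * C / (d * (1 - ε)) + r l : ℝ) : EReal) ≤ -ENNReal.log (optResolution W f l d ε)) ∧
    (∀ k : ℝ, 0 < k → ∃ r : ℝ → ℝ, r =O[atTop] Real.log ∧
      ∀ l : ℝ, 1 < l →
        ((l * C / d + r l : ℝ) : EReal) ≤ -ENNReal.log (optResolution W f l d (l ^ (-k)))) := by
  have hne : Nonempty 𝒴 := ⟨(W 0 true).support_nonempty.some⟩
  have hd0 : (0 : ℝ) < d := by exact_mod_cast hd
  obtain ⟨⟨q, hq, hqC⟩, hmax⟩ := hC
  replace hqC : meanInfoDensity W q (f q) = C := hqC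
  subst hqC
  set C := meanInfoDensity W q (f q) with hCdef
  have hC0 : 0 ≤ C := by
    rw [← meanInfoDensity_of_deterministic (W := W) (Or.inl rfl) (f 0)]
    exact hmax ⟨0, by simp, rfl⟩
  rcases hC0.eq_or_lt with hC0 | hC0
  · refine ⟨fun ε _ => ⟨0, Asymptotics.isBigO_zero _ _, fun l _ => ?_⟩,
      fun k _ => ⟨0, Asymptotics.isBigO_zero _ _, fun l _ => ?_⟩⟩
    · rw [← hC0, mul_zero, zero_div, Pi.zero_apply, add_zero]
      exact zero_le_neg_log_optResolution _ _
    · rw [← hC0, mul_zero, zero_div, Pi.zero_apply, add_zero]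
      exact zero_le_neg_log_optResolution _ _
  have hq' : q ∈ Set.Ioo (0 : ℝ) 1 := by
    refine ⟨hq.1.lt_of_ne' fun h => ?_, hq.2.lt_of_ne fun h => ?_⟩
    · exact hC0.ne' (meanInfoDensity_of_deterministic (Or.inl h) _)
    · exact hC0.ne' (meanInfoDensity_of_deterministic (Or.inr h) _)
  constructor
  · intro ε hε
    obtain ⟨b, hb⟩ := exists_isAdaptive (W := W) (f := f) hq' hd hC0 (k := 1) one_pos
    have h1ε : 0 < 1 - ε := by linarith [hε.2]
    suffices h : ∀ᶠ l : ℝ in atTop, ((l * (C / (d * (1 - ε))) - 4 / d * Real.log l -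
        (b + C / (d * (1 - ε) ^ 2) - 4 / d * Real.log (1 - ε)) : ℝ) : EReal) ≤
        -ENNReal.log (optResolution W f l d ε) by
      obtain ⟨r, hr, hrΦ⟩ := exists_isBigO_log (fun l => zero_le_neg_log_optResolution _ _) h
      refine ⟨r, hr, fun l _ => ?_⟩
      rw [mul_div_assoc]
      exact hrΦ l
    obtain ⟨l₀, hl₀⟩ := eventually_atTop.1 hb
    filter_upwards [eventually_ge_atTop l₀, eventually_ge_atTop (1 / ε)] with l hl hlε
    have hl0 : 0 < l := (one_div_pos.2 hε.1).trans_le hlε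
    -- The player gives up with probability `ε - 1 / l`; the remaining error is at most `1 / l`.
    set lam := 1 - ε + 1 / l with hlam
    have hlε' : 1 / l ≤ ε := by rwa [one_div_le hl0 hε.1]
    have hlpos : 0 < 1 / l := by positivity
    have hlam0 : 0 < lam := by linarith
    have hlam1 : lam ≤ 1 := by linarith
    have hll : l ≤ l / lam := by rw [le_div_iff₀ hlam0]; nlinarith
    obtain ⟨m, hm, hmlog, π, hπ⟩ := hl₀ (l / lam) (hl.trans hll) lam ⟨hlam0.le, hlam1⟩
    have hπ' : π.IsAdaptive W f l (1 / m) ε := by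
      refine hπ.mono (mul_div_cancel₀ _ hlam0.ne').le ?_
      rw [Real.rpow_neg_one, inv_div]
      have : lam * (lam / l) ≤ 1 * (1 / l) := by gcongr
      linarith
    refine le_trans (EReal.coe_le_coe_iff.2 (le_trans ?_ hmlog))
      (log_le_neg_log_optResolution hm hπ')
    have h1 : Real.log (l / lam) ≤ Real.log l - Real.log (1 - ε) := by
      rw [Real.log_div hl0.ne' hlam0.ne']
      have := Real.log_le_log h1ε (by linarith : 1 - ε ≤ lam)
      linarith
    have h2 : l * (C / (d * (1 - ε))) - C / (d * (1 - ε) ^ 2) ≤ l / lam * C / d := by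
      have h3 : l / (1 - ε) - 1 / (1 - ε) ^ 2 ≤ l / lam := by
        rw [le_div_iff₀ hlam0, hlam]
        have : (l / (1 - ε) - 1 / (1 - ε) ^ 2) * (1 - ε + 1 / l) =
            l - 1 / ((1 - ε) ^ 2 * l) := by
          field_simp
          ring
        rw [this]
        have : 0 < 1 / ((1 - ε) ^ 2 * l) := by positivity
        linarith
      calc _ = (l / (1 - ε) - 1 / (1 - ε) ^ 2) * (C / d) := by field_simp
        _ ≤ l / lam * (C / d) := by gcongr
        _ = _ := by ring
    have h4 : 4 / d * Real.log (l / lam) ≤ 4 / d * (Real.log l - Real.log (1 - ε)) := by gcongr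
    have h5 : (2 * (1 : ℝ) + 2) / d = 4 / d := by norm_num
    rw [h5]
    linarith
  · intro k hk
    obtain ⟨b, hb⟩ := exists_isAdaptive (W := W) (f := f) hq' hd hC0 hk
    suffices h : ∀ᶠ l : ℝ in atTop, ((l * (C / d) - (2 * k + 2) / d * Real.log l - b : ℝ) : EReal) ≤
        -ENNReal.log (optResolution W f l d (l ^ (-k))) by
      obtain ⟨r, hr, hrΦ⟩ := exists_isBigO_log (fun l => zero_le_neg_log_optResolution _ _) h
      refine ⟨r, hr, fun l _ => ?_⟩
      rw [mul_div_assoc]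
      exact hrΦ l
    filter_upwards [hb] with l hl
    obtain ⟨m, hm, hmlog, π, hπ⟩ := hl 1 ⟨zero_le_one, le_rfl⟩
    rw [← mul_div_assoc]
    exact le_trans (EReal.coe_le_coe_iff.2 hmlog)
      (log_le_neg_log_optResolution hm (hπ.mono (by simp) (by simp)))
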